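/- **Setup.** Let $\Gamma$ be a graph (possibly infinite) without loops and multiple edges, with vertex set $I$. Put $i\cdot i=2$, $i\cdot j=-1$ if $i,j$ are joined by an edge, and $i\cdot j=0$ otherwise. Let $\nu=\sum_i\nu_i\, i\in\mathbb N[I]$, $m=|\nu|=\sum_i\nu_i$, and let $\mathrm{Seq}(\nu)$ be the set of sequences $\mathbf i=i_1\dots i_m$ of vertices in which each vertex $i$ appears $\nu_i$ times. The group $S_m$ acts on $\mathrm{Seq}(\nu)$: the entry of $\mathbf i$ in position $a$ is the entry of $w(\mathbf i)$ in position $w(a)$. Let $s_k=(k,k+1)$. The ring $R(\nu)$ is generated by $1_{\mathbf i}$, dots $x_{k,\mathbf i}$ ($1\le k\le m$) and crossings $\delta_{k,\mathbf i}$ ($1\le k<m$), $\mathbf i\in\mathrm{Seq}(\nu)$. The $1_{\mathbf i}$ are orthogonal idempotents with sum $1$, $x_{k,\mathbf i}\in 1_{\mathbf i}R(\nu)1_{\mathbf i}$, $\delta_{k,\mathbf i}\in 1_{s_k(\mathbf i)}R(\nu)1_{\mathbf i}$, and the relations are as follows (each applied to $1_{\mathbf i}$; we omit the sequence, which is determined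 by composability, so that $\delta_k\delta_l$ means $\delta_{k,s_l(\mathbf i)}\delta_{l,\mathbf i}$ and so on): - $x_kx_l=x_lx_k$; $\ \delta_kx_l=x_l\delta_k$ for $l\ne k,k+1$; $\ \delta_k\delta_l=\delta_l\delta_k$ for $|k-l|>1$; - $\delta_k^2=0$ if $i_k=i_{k+1}$; $\ \delta_k^2=1$ if $i_k\cdot i_{k+1}=0$; $\ \delta_k^2=x_k+x_{k+1}$ if $i_k\cdot i_{k+1}=-1$; - $x_k\delta_k=\delta_kx_{k+1}$ and $x_{k+1}\delta_k=\delta_kx_k$ if $i_k\ne i_{k+1}$; $\ x_k\delta_k-\delta_kx_{k+1}=1=\delta_kx_k-x_{k+1}\delta_k$ if $i_k=i_{k+1}$; - $\delta_k\delta_{k+1}\delta_k-\delta_{k+1}\delta_k\delta_{k+1}$ equals $1$ if $i_k=i_{k+2}$ and $i_k\cdot i_{k+1}=-1$, and equals $0$ otherwise. A diagram from $\mathbf i$ to $\mathbf j$ is a composable product of generators with rightmost (bottom) sequence $\mathbf i$ and leftmost (top) sequence $\mathbf j$. Its degree is the sum of the degrees $\deg 1_{\mathbf i}=0$, $\deg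 x_{k,\mathbf i}=2$, $\deg\delta_{k,\mathbf i}=-i_k\cdot i_{k+1}$. The degree $d$ part of $R(\nu)$ is the span of the diagrams of degree $d$, and the degree $d$ part of $1_{\mathbf j}R(\nu)1_{\mathbf i}$ is its intersection with $1_{\mathbf j}R(\nu)1_{\mathbf i}$. For each $w\in S_m$ fix a minimal presentation (reduced word) $w=s_{k_1}\cdots s_{k_r}$, and let $\hat w_{\mathbf i}=\delta_{k_1}\cdots\delta_{k_r}1_{\mathbf i}$ be the corresponding diagram with bottom sequence $\mathbf i$. Let ${}_{\mathbf j}S_{\mathbf i}=\{w\in S_m: w(\mathbf i)=\mathbf j\}$. **Theorem 2.5.** For any choice of minimal presentations the following hold. 1. For all $\mathbf i,\mathbf j\in\mathrm{Seq}(\nu)$, the abelian group $1_{\mathbf j}R(\nu)1_{\mathbf i}$ is the direct sum of its degree $d$ parts, $d\in\mathbb Z$, and it is free with a basis consisting of the elements $$\hat w_{\mathbf i}\,x_{1,\mathbf i}^{u_1}\cdots x_{m,\mathbf i}^{u_m},\qquad w\in{}_{\mathbf j}S_{\mathbf i},\quad (u_1,\dots,u_m)\in\mathbb N^m$$ (distinct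 pairs $(w,u)$ giving distinct elements). Each of them is homogeneous, of degree the degree of the diagram $\hat w_{\mathbf i}$ plus $2\sum_k u_k$. 2. Choose any orientation of the edges of $\Gamma$, and let $\mathcal Pol_\nu=\bigoplus_{\mathbf i\in\mathrm{Seq}(\nu)}\mathcal Pol_{\mathbf i}$ with $\mathcal Pol_{\mathbf i}=\mathbb Z[x_1,\dots,x_m]$. There is a unique action of $R(\nu)$ on $\mathcal Pol_\nu$ such that $1_{\mathbf i}$ is the projection to $\mathcal Pol_{\mathbf i}$, $x_{k,\mathbf i}$ acts on $\mathcal Pol_{\mathbf i}$ by multiplication by $x_k$, and $\delta_{k,\mathbf i}$ maps $f\in\mathcal Pol_{\mathbf i}$ to the following element of $\mathcal Pol_{s_k(\mathbf i)}$: to $\frac{f-s_kf}{x_k-x_{k+1}}$ if $i_k=i_{k+1}$; to $s_kf$ if $i_k\cdot i_{k+1}=0$ or the edge is oriented $i_k\leftarrow i_{k+1}$; to $(x_k+x_{k+1})\,s_kf$ if it is oriented $i_k\to i_{k+1}$. (Here $s_kf$ is $f$ with $x_k$ and $x_{k+1}$ exchanged.) This representation is faithful. -/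

import Mathlib

namespace KL

universe u

variable {I : Type u}

/-- The length `m = |ν|` of an element `ν = ∑ ν_i · i` of `ℕ[I]`. -/
def len (ν : I →₀ ℕ) : ℕ := ν.sum fun _ n => n

/-- The (0-based) position of the left one of the two strands meeting in the `k`-th crossing. -/
def lpos {m : ℕ} (k : Fin (m - 1)) : Fin m := ⟨k.1, by have := k.2; omega⟩

/-- The (0-based) position of the right one of the two strands meeting in the `k`-th crossing. -/
def rpos {m : ℕ} (k : Fin (m - 1)) : Fin m := ⟨k.1 + 1, by have := k.2; omega⟩

/-- The simple transposition `s_k = (k, k+1)` of the symmetric group on `m` letters. -/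
def simpleTr {m : ℕ} (k : Fin (m - 1)) : Equiv.Perm (Fin m) := Equiv.swap (lpos k) (rpos k)

/-- The product `s_{k₁} ⋯ s_{k_r}` of a word in the simple transpositions. -/
def wordProd {m : ℕ} (l : List (Fin (m - 1))) : Equiv.Perm (Fin m) := (l.map simpleTr).prod

/-- The word `l` is a minimal presentation (reduced word) of the permutation `w`. -/
def IsMinimalPresentation {m : ℕ} (l : List (Fin (m - 1))) (w : Equiv.Perm (Fin m)) : Prop :=
  wordProd l = w ∧ ∀ l' : List (Fin (m - 1)), wordProd l' = w → l.length ≤ l'.length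

/-- `Seq(ν)`: the sequences of vertices of length `|ν|` in which every vertex `v` appears
`ν_v` times. -/
@[ext] structure Seq (ν : I →₀ ℕ) where
  vertex : Fin (len ν) → I
  card_eq : ∀ v : I, Nat.card {a // vertex a = v} = ν v

instance Seq.instFinite (ν : I →₀ ℕ) : Finite (Seq ν) := by
  have hmem : ∀ (i : Seq ν) (a : Fin (len ν)), i.vertex a ∈ ν.support := by
    intro i a
    rw [Finsupp.mem_support_iff, ← i.card_eq]
    have : Nonempty {b // i.vertex b = i.vertex a} := ⟨⟨a, rfl⟩⟩
    exact Nat.card_pos.ne'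
  refine Finite.of_injective
    (fun (i : Seq ν) (a : Fin (len ν)) => (⟨i.vertex a, hmem i a⟩ : ν.support)) ?_
  intro i j h
  ext a
  exact congrArg Subtype.val (congrFun h a)

noncomputable instance Seq.instFintype (ν : I →₀ ℕ) : Fintype (Seq ν) := Fintype.ofFinite _

/-- The action of permutations on sequences: the entry of `i` in position `a` is the entry of
`w(i)` in position `w(a)`. -/
def Seq.perm {ν : I →₀ ℕ} (w : Equiv.Perm (Fin (len ν))) (i : Seq ν) : Seq ν where
  vertex a := i.vertex (w.symm a)
  card_eq v := by
    rw [← i.card_eq v]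
    exact Nat.card_congr (w.symm.subtypeEquiv fun _ => Iff.rfl)

/-- `s_k(i)`: the entries in positions `k` and `k+1` are switched. -/
def Seq.swap {ν : I →₀ ℕ} (k : Fin (len ν - 1)) (i : Seq ν) : Seq ν := i.perm (simpleTr k)

/-- The set `_jS_i` of the permutations that take `i` to `j`. -/
def permSet {ν : I →₀ ℕ} (j i : Seq ν) : Set (Equiv.Perm (Fin (len ν))) := {w | i.perm w = j}

open Classical in
/-- The Cartan form `i · j` on vertices. -/
noncomputable def cartan (Γ : SimpleGraph I) (i j : I) : ℤ :=
  if i = j then 2 else if Γ.Adj i j then -1 else 0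

/-- The elementary diagrams: the vertical strands `1_i`, a single dot on the `k`-th strand
`x_{k,i}`, and a single crossing `δ_{k,i}` of the strands in positions `k`, `k+1`. The sequence
`i` is the sequence of labels at the bottom. -/
inductive Gen (ν : I →₀ ℕ) : Type u
  | idem (i : Seq ν) : Gen ν
  | dot (k : Fin (len ν)) (i : Seq ν) : Gen ν
  | cross (k : Fin (len ν - 1)) (i : Seq ν) : Gen ν

section Free

variable {ν : I →₀ ℕ}

/-- `1_i` in the free ring on the elementary diagrams. -/
def fe (i : Seq ν) : FreeAlgebra ℤ (Gen ν) := FreeAlgebra.ι ℤ (Gen.idem i)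

/-- `x_{k,i}` in the free ring on the elementary diagrams. -/
def fx (k : Fin (len ν)) (i : Seq ν) : FreeAlgebra ℤ (Gen ν) := FreeAlgebra.ι ℤ (Gen.dot k i)

/-- `δ_{k,i}` in the free ring on the elementary diagrams. -/
def fd (k : Fin (len ν - 1)) (i : Seq ν) : FreeAlgebra ℤ (Gen ν) :=
  FreeAlgebra.ι ℤ (Gen.cross k i)

end Free

/-- The defining relations of `R(ν)`. A product `a * b` is the diagram of `a` put on top of the
diagram of `b`. -/
inductive Rel (Γ : SimpleGraph I) (ν : I →₀ ℕ) :
    FreeAlgebra ℤ (Gen ν) → FreeAlgebra ℤ (Gen ν) → Prop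
  -- Diagrams can be stacked only if the labels match, and are zero otherwise.
  | idem_mul_self (i : Seq ν) : Rel Γ ν (fe i * fe i) (fe i)
  | idem_mul_ne (i j : Seq ν) (h : i ≠ j) : Rel Γ ν (fe i * fe j) 0
  | sum_idem : Rel Γ ν (∑ i : Seq ν, fe i) 1
  | dot_bot (k : Fin (len ν)) (i : Seq ν) : Rel Γ ν (fx k i * fe i) (fx k i)
  | dot_top (k : Fin (len ν)) (i : Seq ν) : Rel Γ ν (fe i * fx k i) (fx k i)
  | cross_bot (k : Fin (len ν - 1)) (i : Seq ν) : Rel Γ ν (fd k i * fe i) (fd k i)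
  | cross_top (k : Fin (len ν - 1)) (i : Seq ν) : Rel Γ ν (fe (i.swap k) * fd k i) (fd k i)
  -- Isotopy: dots and crossings on disjoint sets of strands can be moved past each other.
  | dot_dot (k l : Fin (len ν)) (i : Seq ν) : Rel Γ ν (fx k i * fx l i) (fx l i * fx k i)
  | cross_dot (k : Fin (len ν - 1)) (l : Fin (len ν)) (i : Seq ν)
      (hl : l ≠ lpos k) (hr : l ≠ rpos k) :
      Rel Γ ν (fd k i * fx l i) (fx l (i.swap k) * fd k i)
  | cross_cross (k l : Fin (len ν - 1)) (i : Seq ν) (h : k.1 + 1 < l.1) :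
      Rel Γ ν (fd k (i.swap l) * fd l i) (fd l (i.swap k) * fd k i)
  -- Two strands crossing twice.
  | double_eq (k : Fin (len ν - 1)) (i : Seq ν) (h : i.vertex (lpos k) = i.vertex (rpos k)) :
      Rel Γ ν (fd k (i.swap k) * fd k i) 0
  | double_far (k : Fin (len ν - 1)) (i : Seq ν) (hne : i.vertex (lpos k) ≠ i.vertex (rpos k))
      (h : ¬ Γ.Adj (i.vertex (lpos k)) (i.vertex (rpos k))) :
      Rel Γ ν (fd k (i.swap k) * fd k i) (fe i)
  | double_adj (k : Fin (len ν - 1)) (i : Seq ν)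
      (h : Γ.Adj (i.vertex (lpos k)) (i.vertex (rpos k))) :
      Rel Γ ν (fd k (i.swap k) * fd k i) (fx (lpos k) i + fx (rpos k) i)
  -- Sliding a dot through a crossing of strands with different labels.
  | slide_ne_left (k : Fin (len ν - 1)) (i : Seq ν)
      (h : i.vertex (lpos k) ≠ i.vertex (rpos k)) :
      Rel Γ ν (fx (lpos k) (i.swap k) * fd k i) (fd k i * fx (rpos k) i)
  | slide_ne_right (k : Fin (len ν - 1)) (i : Seq ν)
      (h : i.vertex (lpos k) ≠ i.vertex (rpos k)) :
      Rel Γ ν (fx (rpos k) (i.swap k) * fd k i) (fd k i * fx (lpos k) i)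
  -- Sliding a dot through a crossing of strands with equal labels.
  | slide_eq_left (k : Fin (len ν - 1)) (i : Seq ν)
      (h : i.vertex (lpos k) = i.vertex (rpos k)) :
      Rel Γ ν (fx (lpos k) (i.swap k) * fd k i - fd k i * fx (rpos k) i) (fe i)
  | slide_eq_right (k : Fin (len ν - 1)) (i : Seq ν)
      (h : i.vertex (lpos k) = i.vertex (rpos k)) :
      Rel Γ ν (fd k i * fx (lpos k) i - fx (rpos k) (i.swap k) * fd k i) (fe i)
  -- Triple crossings, of the strands in positions `k`, `k+1`, `k+2`, where `l = k+1`.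
  | braid_easy (k l : Fin (len ν - 1)) (hkl : l.1 = k.1 + 1) (i : Seq ν)
      (h : ¬ (i.vertex (lpos k) = i.vertex (rpos l) ∧
        Γ.Adj (i.vertex (lpos k)) (i.vertex (rpos k)))) :
      Rel Γ ν (fd k ((i.swap k).swap l) * fd l (i.swap k) * fd k i)
        (fd l ((i.swap l).swap k) * fd k (i.swap l) * fd l i)
  | braid_hard (k l : Fin (len ν - 1)) (hkl : l.1 = k.1 + 1) (i : Seq ν)
      (h : i.vertex (lpos k) = i.vertex (rpos l))
      (hadj : Γ.Adj (i.vertex (lpos k)) (i.vertex (rpos k))) :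
      Rel Γ ν (fd k ((i.swap k).swap l) * fd l (i.swap k) * fd k i
        - fd l ((i.swap l).swap k) * fd k (i.swap l) * fd l i) (fe i)

/-- The ring `R(ν)` of the graph `Γ`. -/
def R (Γ : SimpleGraph I) (ν : I →₀ ℕ) : Type u := RingQuot (Rel Γ ν)

noncomputable instance R.instRing (Γ : SimpleGraph I) (ν : I →₀ ℕ) : Ring (R Γ ν) :=
  inferInstanceAs (Ring (RingQuot (Rel Γ ν)))

section Ring

variable (Γ : SimpleGraph I) {ν : I →₀ ℕ}

/-- The quotient map from the free ring to `R(ν)`. -/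
noncomputable def mk (ν : I →₀ ℕ) : FreeAlgebra ℤ (Gen ν) →+* R Γ ν := RingQuot.mkRingHom (Rel Γ ν)

/-- The idempotent `1_i` of `R(ν)`. -/
noncomputable def e (i : Seq ν) : R Γ ν := mk Γ ν (fe i)

/-- The dot `x_{k,i}` of `R(ν)`. -/
noncomputable def x (k : Fin (len ν)) (i : Seq ν) : R Γ ν := mk Γ ν (fx k i)

/-- The crossing `δ_{k,i}` of `R(ν)`. -/
noncomputable def δ (k : Fin (len ν - 1)) (i : Seq ν) : R Γ ν := mk Γ ν (fd k i)

/-- The summand `_jR(ν)_i = 1_j R(ν) 1_i`, as a subgroup of `R(ν)`. -/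
noncomputable def homPart (j i : Seq ν) : Submodule ℤ (R Γ ν) where
  carrier := {r | ∃ s : R Γ ν, r = e Γ j * s * e Γ i}
  add_mem' := by
    rintro _ _ ⟨s, rfl⟩ ⟨t, rfl⟩
    exact ⟨s + t, by rw [mul_add, add_mul]⟩
  zero_mem' := ⟨0, by rw [mul_zero, zero_mul]⟩
  smul_mem' := by
    rintro c _ ⟨s, rfl⟩
    exact ⟨c • s, by rw [mul_smul_comm, smul_mul_assoc]⟩

end Ring

/-- `Diagram i j` is the type of diagrams with bottom `i` and top `j`, built from the bottom to
the top by adding one dot or one crossing at a time. -/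
inductive Diagram {ν : I →₀ ℕ} (i : Seq ν) : Seq ν → Type u
  | id : Diagram i i
  | dot (k : Fin (len ν)) {j : Seq ν} (D : Diagram i j) : Diagram i j
  | cross (k : Fin (len ν - 1)) {j : Seq ν} (D : Diagram i j) : Diagram i (j.swap k)

section Diagrams

variable (Γ : SimpleGraph I) {ν : I →₀ ℕ}

/-- The element of `R(ν)` represented by a diagram. -/
noncomputable def Diagram.eval {i : Seq ν} : {j : Seq ν} → Diagram i j → R Γ ν
  | _, .id => e Γ i
  | _, .dot k (j := j) D => x Γ k j * D.eval
  | _, .cross k (j := j) D => δ Γ k j * D.eval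

/-- The degree of a diagram: a dot has degree `2`, a crossing of strands labelled `a`, `b` has
degree `- a · b`. -/
noncomputable def Diagram.degree {i : Seq ν} : {j : Seq ν} → Diagram i j → ℤ
  | _, .id => 0
  | _, .dot _ D => 2 + D.degree
  | _, .cross k (j := j) D => -cartan Γ (j.vertex (lpos k)) (j.vertex (rpos k)) + D.degree

/-- The degree `d` part of `R(ν)`, spanned by the diagrams of degree `d`. -/
noncomputable def degPart (ν : I →₀ ℕ) (d : ℤ) : Submodule ℤ (R Γ ν) :=
  Submodule.span ℤ {r | ∃ (i j : Seq ν) (D : Diagram i j), D.degree Γ = d ∧ r = D.eval Γ}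

/-- The degree `d` part of `_jR(ν)_i`. -/
noncomputable def homDegPart (j i : Seq ν) (d : ℤ) : Submodule ℤ (homPart Γ j i) :=
  (degPart Γ ν d).comap (homPart Γ j i).subtype

/-- The sequence obtained from `i` by applying `s_{k_r}`, …, `s_{k₁}` in this order. -/
def Seq.act (i : Seq ν) : List (Fin (len ν - 1)) → Seq ν
  | [] => i
  | k :: l => (i.act l).swap k

/-- The diagram with bottom `i` and no dots given by a word `s_{k₁} ⋯ s_{k_r}`, the last letter
of the word being the lowest crossing. -/
def wordDiagram (i : Seq ν) : (l : List (Fin (len ν - 1))) → Diagram i (i.act l)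
  | [] => .id
  | k :: l => .cross k (wordDiagram i l)

/-- The element `ŵ_i` obtained from a presentation `l` of the permutation `w`. -/
noncomputable def hat (l : List (Fin (len ν - 1))) (i : Seq ν) : R Γ ν := (wordDiagram i l).eval Γ

/-- The dot monomial `x_{1,i}^{u_1} ⋯ x_{m,i}^{u_m}` (the factors commute). -/
noncomputable def dotMonomial (i : Seq ν) (u : Fin (len ν) → ℕ) : R Γ ν :=
  (List.ofFn fun k => x Γ k i ^ u k).prod

end Diagrams

/-- A choice of an orientation of each edge of `Γ`; `arrow i j` means that `i` and `j` are joined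
by an edge which is oriented from `i` to `j`. -/
structure Orientation (Γ : SimpleGraph I) where
  arrow : I → I → Prop
  adj_iff : ∀ i j, Γ.Adj i j ↔ arrow i j ∨ arrow j i
  asymm : ∀ i j, arrow i j → ¬ arrow j i

/-- The group `Pol_ν`, the direct sum over `i ∈ Seq(ν)` of the groups `Pol_i = ℤ[x_1, …, x_m]`.
The element `f ∈ Pol_i` is `Finsupp.single i f`. -/
abbrev Pol (ν : I →₀ ℕ) : Type u := Seq ν →₀ MvPolynomial (Fin (len ν)) ℤ

/-- The map `f ↦ s_k f` from `Pol_i` to `Pol_{s_k(i)}`, on the underlying polynomials. -/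
noncomputable def sPol {m : ℕ} (k : Fin (m - 1)) (f : MvPolynomial (Fin m) ℤ) :
    MvPolynomial (Fin m) ℤ :=
  MvPolynomial.rename (simpleTr k) f

open MvPolynomial in
/-- The ring homomorphism `ρ` is the action of `R(ν)` on `Pol_ν` attached to an orientation of
`Γ`: the generators act by the following rules. (An element of `_jR(ν)_i` then acts by zero on
`Pol_k`, `k ≠ i`, and maps `Pol_i` to `Pol_j`.) -/
structure IsPolAction {Γ : SimpleGraph I} (o : Orientation Γ) {ν : I →₀ ℕ}
    (ρ : R Γ ν →+* Module.End ℤ (Pol ν)) : Prop where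
  idem_self : ∀ (i : Seq ν) (f : MvPolynomial (Fin (len ν)) ℤ),
    ρ (e Γ i) (Finsupp.single i f) = Finsupp.single i f
  idem_ne : ∀ (i j : Seq ν) (f : MvPolynomial (Fin (len ν)) ℤ), j ≠ i →
    ρ (e Γ i) (Finsupp.single j f) = 0
  dot : ∀ (k : Fin (len ν)) (i : Seq ν) (f : MvPolynomial (Fin (len ν)) ℤ),
    ρ (x Γ k i) (Finsupp.single i f) = Finsupp.single i (X k * f)
  cross_far : ∀ (k : Fin (len ν - 1)) (i : Seq ν) (f : MvPolynomial (Fin (len ν)) ℤ),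
    i.vertex (lpos k) ≠ i.vertex (rpos k) →
    ¬ Γ.Adj (i.vertex (lpos k)) (i.vertex (rpos k)) →
    ρ (δ Γ k i) (Finsupp.single i f) = Finsupp.single (i.swap k) (sPol k f)
  /-- For equal labels the crossing acts by the divided difference
  `g = (f - s_k f) / (x_k - x_{k+1})`. -/
  cross_eq : ∀ (k : Fin (len ν - 1)) (i : Seq ν) (f : MvPolynomial (Fin (len ν)) ℤ),
    i.vertex (lpos k) = i.vertex (rpos k) →
    ∃ g : MvPolynomial (Fin (len ν)) ℤ, (X (lpos k) - X (rpos k)) * g = f - sPol k f ∧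
      ρ (δ Γ k i) (Finsupp.single i f) = Finsupp.single (i.swap k) g
  cross_left : ∀ (k : Fin (len ν - 1)) (i : Seq ν) (f : MvPolynomial (Fin (len ν)) ℤ),
    o.arrow (i.vertex (rpos k)) (i.vertex (lpos k)) →
    ρ (δ Γ k i) (Finsupp.single i f) = Finsupp.single (i.swap k) (sPol k f)
  cross_right : ∀ (k : Fin (len ν - 1)) (i : Seq ν) (f : MvPolynomial (Fin (len ν)) ℤ),
    o.arrow (i.vertex (lpos k)) (i.vertex (rpos k)) →
    ρ (δ Γ k i) (Finsupp.single i f) =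
      Finsupp.single (i.swap k) ((X (lpos k) + X (rpos k)) * sPol k f)

end KL

/-! The elements `ŵ_i x^u` span: dots slide to the bottom of a diagram, and braid moves as well as
the removal of a double crossing alter a diagram only by diagrams with fewer crossings. By braid
moves any two reduced words of a permutation become equal, and every non-reduced word acquires a
double crossing.

They are independent because they act independently on `Pol_ν`. Over the field of rational functions
in the dots, `ŵ` acts as a nonzero multiple of the automorphism `w` plus a combination of
automorphisms with shorter words, and distinct automorphisms are linearly independent by Dedekind's
theorem. The same argument gives faithfulness.

The relations are homogeneous, so that recording degrees by a formal variable `T` defines a ring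
homomorphism from `R(ν)` to `R(ν)[T, T⁻¹]`, whose coefficients separate the parts of different
degrees. -/

namespace KL

/-! ### Words in the simple transpositions -/

section Words

variable {N : ℕ}

/-- The word consists of the consecutive letters `j, j + 1, j + 2, …`. -/
def IsRun : ℕ → List (Fin N) → Prop
  | _, [] => True
  | j, a :: s => a.val = j ∧ IsRun (j + 1) s

theorem IsRun.le_and_lt {j : ℕ} {s : List (Fin N)} (hs : IsRun j s) {a : Fin N} (ha : a ∈ s) :
    j ≤ a.val ∧ a.val < j + s.length := by
  induction s generalizing j with
  | nil => exact absurd ha List.not_mem_nil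
  | cons b s ih =>
    rw [List.length_cons]
    rcases List.mem_cons.1 ha with rfl | ha
    · have := hs.1
      omega
    · have := ih hs.2 ha
      omega

theorem IsRun.eq_of_length_eq {j : ℕ} {s t : List (Fin N)} (hs : IsRun j s) (ht : IsRun j t)
    (h : s.length = t.length) : s = t := by
  induction s generalizing j t with
  | nil => exact (List.eq_nil_of_length_eq_zero h.symm).symm
  | cons a s ih =>
    obtain ⟨b, t, rfl⟩ := List.exists_cons_of_length_eq_add_one h.symm
    rw [ih hs.2 ht.2 (Nat.succ_inj.1 h), Fin.ext (hs.1.trans ht.1.symm)]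

/-- The congruence on words in the letters `0, …, N - 1` generated by the braid relations of the
symmetric group on `N + 1` letters. -/
inductive BraidEquiv : List (Fin N) → List (Fin N) → Prop
  | refl (l) : BraidEquiv l l
  | symm {l l'} : BraidEquiv l l' → BraidEquiv l' l
  | trans {l l' l''} : BraidEquiv l l' → BraidEquiv l' l'' → BraidEquiv l l''
  | cons (a) {l l'} : BraidEquiv l l' → BraidEquiv (a :: l) (a :: l')
  | far (a b l) : a.val + 1 < b.val → BraidEquiv (a :: b :: l) (b :: a :: l)
  | braid (a b l) : b.val = a.val + 1 → BraidEquiv (a :: b :: a :: l) (b :: a :: b :: l)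

namespace BraidEquiv

theorem append_left (t : List (Fin N)) {l l' : List (Fin N)} (h : BraidEquiv l l') :
    BraidEquiv (t ++ l) (t ++ l') := by
  induction t with
  | nil => exact h
  | cons a t ih => exact ih.cons a

theorem length_eq {l l' : List (Fin N)} (h : BraidEquiv l l') : l.length = l'.length := by
  induction h with
  | refl => rfl
  | symm _ ih => exact ih.symm
  | trans _ _ ih ih' => exact ih.trans ih'
  | cons _ _ ih => exact congrArg (· + 1) ih
  | far => rfl
  | braid => rfl

theorem cons_append_of_far {k : Fin N} {s : List (Fin N)} (t : List (Fin N))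
    (h : ∀ a ∈ s, k.val + 1 < a.val) : BraidEquiv (k :: (s ++ t)) (s ++ k :: t) := by
  induction s with
  | nil => exact .refl _
  | cons a s ih =>
    rw [List.forall_mem_cons] at h
    exact (far k a _ h.1).trans ((ih h.2).cons a)

theorem cons_append_of_isRun {k k' : Fin N} (hk : k'.val = k.val + 1) {j : ℕ} {s : List (Fin N)}
    (hs : IsRun j s) (t : List (Fin N)) (hj : j ≤ k.val) (hlt : k'.val < j + s.length) :
    BraidEquiv (k' :: (s ++ t)) (s ++ k :: t) := by
  induction s generalizing j with
  | nil => rw [List.length_nil] at hlt; omega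
  | cons a s ih =>
    obtain ⟨ha, hs⟩ := hs
    rw [List.length_cons] at hlt
    rcases hj.eq_or_lt with hj | hj
    · obtain rfl : a = k := Fin.ext (ha.trans hj)
      rcases s with _ | ⟨b, s⟩
      · rw [List.length_nil] at hlt; omega
      · obtain rfl : b = k' := Fin.ext (by rw [hs.1, hk, hj])
        have hfar : ∀ c ∈ s, a.val + 1 < c.val := fun c hc => by
          have := (hs.2.le_and_lt hc).1
          omega
        exact (braid a b _ hk).symm.trans (((cons_append_of_far t hfar).cons b).cons a)
    · exact (far a k' _ (by omega)).symm.trans ((ih hs hj (by omega)).cons a)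

end BraidEquiv

/-- The word can be brought by braid moves to a form with two equal adjacent letters. -/
def HasSquare (l : List (Fin N)) : Prop := ∃ a s b, BraidEquiv l (a ++ s :: s :: b)

theorem HasSquare.append_left (t : List (Fin N)) {l : List (Fin N)} (h : HasSquare l) :
    HasSquare (t ++ l) := by
  obtain ⟨a, s, b, h⟩ := h
  exact ⟨t ++ a, s, b, by simpa using h.append_left t⟩

theorem BraidEquiv.hasSquare {l l' : List (Fin N)} (h : BraidEquiv l l') (h' : HasSquare l') :
    HasSquare l := by
  obtain ⟨a, s, b, h'⟩ := h'
  exact ⟨a, s, b, h.trans h'⟩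

/-- The normal form of a word in the letters smaller than `n`: an ascending run of consecutive
letters which is empty or ends with `n - 1`, followed by a normal word in the letters smaller than
`n - 1`. The runs are reduced words for the minimal coset representatives of `S_n` in `S_{n+1}`. -/
def IsNormalWord : ℕ → List (Fin N) → Prop
  | 0, l => l = []
  | n + 1, l => ∃ j s l', IsRun j s ∧ j + s.length = n + 1 ∧ IsNormalWord n l' ∧ l = s ++ l'

theorem isNormalWord_nil (n : ℕ) : IsNormalWord n ([] : List (Fin N)) := by
  induction n with
  | zero => rfl
  | succ n ih => exact ⟨n + 1, [], [], trivial, rfl, ih, rfl⟩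

theorem IsNormalWord.lt {n : ℕ} {l : List (Fin N)} (hl : IsNormalWord n l) :
    ∀ k ∈ l, k.val < n := by
  induction n generalizing l with
  | zero => obtain rfl := hl; simp
  | succ n ih =>
    obtain ⟨j, s, l, hs, hj, hl, rfl⟩ := hl
    intro k hk
    rcases List.mem_append.1 hk with hk | hk
    · exact hj ▸ (hs.le_and_lt hk).2
    · exact (ih hl k hk).trans n.lt_add_one

theorem IsNormalWord.cons {n : ℕ} {k : Fin N} {l : List (Fin N)} (hl : IsNormalWord n l)
    (hk : k.val < n) : (∃ c, IsNormalWord n c ∧ BraidEquiv (k :: l) c) ∨ HasSquare (k :: l) := by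
  induction n generalizing k l with
  | zero => omega
  | succ n ih =>
    obtain ⟨j, s, l, hs, hj, hl, rfl⟩ := hl
    have of_slide (k' : Fin N) (hk' : k'.val < n) (h : BraidEquiv (k :: (s ++ l)) (s ++ k' :: l)) :
        (∃ c, IsNormalWord (n + 1) c ∧ BraidEquiv (k :: (s ++ l)) c) ∨
          HasSquare (k :: (s ++ l)) := by
      rcases ih hl hk' with ⟨c, hc, h'⟩ | h'
      · exact .inl ⟨_, ⟨j, s, c, hs, hj, hc, rfl⟩, h.trans (h'.append_left s)⟩
      · exact .inr (h.hasSquare (h'.append_left s))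
    rcases lt_trichotomy (k.val + 1) j with hkj | hkj | hkj
    · refine of_slide k (by omega) (.cons_append_of_far l fun a ha => ?_)
      exact hkj.trans_le (hs.le_and_lt ha).1
    · exact .inl ⟨_, ⟨k, k :: s, l, ⟨rfl, hkj ▸ hs⟩, by rw [List.length_cons]; omega, hl, rfl⟩,
        .refl _⟩
    · rcases (Nat.lt_succ_iff.1 hkj).eq_or_lt with rfl | hkj
      · rcases s with _ | ⟨b, s⟩
        · rw [List.length_nil] at hj; omega
        · obtain rfl : b = k := Fin.ext hs.1
          exact .inr ⟨[], b, s ++ l, .refl _⟩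
      · have hk1 : k.val = k.val - 1 + 1 := by omega
        exact of_slide ⟨k.val - 1, by omega⟩ (by rw [Fin.val_mk]; omega)
          (.cons_append_of_isRun hk1 hs l (Nat.le_sub_one_of_lt hkj) (by omega))

theorem exists_isNormalWord (l : List (Fin N)) :
    (∃ c, IsNormalWord N c ∧ BraidEquiv l c) ∨ HasSquare l := by
  induction l with
  | nil => exact .inl ⟨[], isNormalWord_nil N, .refl _⟩
  | cons k l ih =>
    rcases ih with ⟨c, hc, h⟩ | h
    · rcases hc.cons k.2 with ⟨c', hc', h'⟩ | h'
      · exact .inl ⟨c', hc', (h.cons k).trans h'⟩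
      · exact .inr ((h.cons k).hasSquare h')
    · exact .inr (h.append_left [k])

end Words

section SimpleTranspositions

variable {m : ℕ} {k l : Fin (m - 1)}

theorem wordProd_cons (k : Fin (m - 1)) (s : List (Fin (m - 1))) :
    wordProd (k :: s) = simpleTr k * wordProd s := by
  simp only [wordProd, List.map_cons, List.prod_cons]

theorem wordProd_append (s t : List (Fin (m - 1))) :
    wordProd (s ++ t) = wordProd s * wordProd t := by
  simp only [wordProd, List.map_append, List.prod_append]

theorem simpleTr_mul_self (k : Fin (m - 1)) : simpleTr k * simpleTr k = 1 :=
  Equiv.swap_mul_self _ _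

theorem simpleTr_lpos (k : Fin (m - 1)) : simpleTr k (lpos k) = rpos k := Equiv.swap_apply_left _ _

theorem simpleTr_rpos (k : Fin (m - 1)) : simpleTr k (rpos k) = lpos k := Equiv.swap_apply_right _ _

theorem simpleTr_of_ne {a : Fin m} (hl : a ≠ lpos k) (hr : a ≠ rpos k) : simpleTr k a = a :=
  Equiv.swap_apply_of_ne_of_ne hl hr

theorem val_simpleTr (k : Fin (m - 1)) (a : Fin m) :
    (simpleTr k a : ℕ) = Equiv.swap (k : ℕ) (k + 1) a := by
  simp only [simpleTr, Equiv.swap_apply_def, Fin.ext_iff, lpos, rpos]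
  split_ifs <;> rfl

theorem simpleTr_mul_simpleTr_of_far (h : k.val + 1 < l.val) :
    simpleTr k * simpleTr l = simpleTr l * simpleTr k := by
  ext a
  simp only [Equiv.Perm.mul_apply, val_simpleTr, Equiv.swap_apply_def]
  split_ifs <;> omega

theorem simpleTr_braid (h : l.val = k.val + 1) :
    simpleTr k * (simpleTr l * simpleTr k) = simpleTr l * (simpleTr k * simpleTr l) := by
  ext a
  simp only [Equiv.Perm.mul_apply, val_simpleTr, h, Equiv.swap_apply_def]
  split_ifs <;> omega

theorem BraidEquiv.wordProd_eq {s t : List (Fin (m - 1))} (h : BraidEquiv s t) :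
    wordProd s = wordProd t := by
  induction h with
  | refl => rfl
  | symm _ ih => exact ih.symm
  | trans _ _ ih ih' => exact ih.trans ih'
  | cons k _ ih => rw [wordProd_cons, wordProd_cons, ih]
  | far k l s h =>
    simp only [wordProd_cons, ← mul_assoc, simpleTr_mul_simpleTr_of_far h]
  | braid k l s h =>
    simpa only [wordProd_cons, mul_assoc] using congrArg (· * wordProd s) (simpleTr_braid h)

theorem IsMinimalPresentation.not_hasSquare {s : List (Fin (m - 1))} {w : Equiv.Perm (Fin m)}
    (hs : IsMinimalPresentation s w) : ¬ HasSquare s := by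
  rintro ⟨a, k, b, h⟩
  have hab : wordProd (a ++ b) = w := by
    rw [← hs.1, h.wordProd_eq, wordProd_append, wordProd_append, wordProd_cons, wordProd_cons,
      ← mul_assoc (simpleTr k), simpleTr_mul_self, one_mul]
  have hshort := hs.2 _ hab
  rw [h.length_eq] at hshort
  simp only [List.length_append, List.length_cons] at hshort
  omega

theorem wordProd_apply_of_forall_lt {n : ℕ} {s : List (Fin (m - 1))} (hs : ∀ k ∈ s, k.val < n)
    {a : Fin m} (ha : n < a.val) : wordProd s a = a := by
  induction s with
  | nil => rfl
  | cons k s ih =>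
    rw [List.forall_mem_cons] at hs
    rw [wordProd_cons, Equiv.Perm.mul_apply, ih hs.2, simpleTr_of_ne] <;>
      simp only [ne_eq, Fin.ext_iff, lpos, rpos] <;> omega

theorem IsRun.val_wordProd_apply {j : ℕ} {s : List (Fin (m - 1))} (hs : IsRun j s) {a : Fin m}
    (ha : a.val = j + s.length) : (wordProd s a).val = j := by
  induction s generalizing j with
  | nil => exact ha
  | cons k s ih =>
    rw [List.length_cons] at ha
    rw [wordProd_cons, Equiv.Perm.mul_apply, val_simpleTr, ih hs.2 (by omega), hs.1,
      Equiv.swap_apply_right]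

theorem IsNormalWord.eq_of_wordProd_eq {n : ℕ} (hn : n ≤ m - 1) {s t : List (Fin (m - 1))}
    (hs : IsNormalWord n s) (ht : IsNormalWord n t) (h : wordProd s = wordProd t) : s = t := by
  induction n generalizing s t with
  | zero => exact hs.trans ht.symm
  | succ n ih =>
    have start_eq {j : ℕ} {s₁ s₂ : List (Fin (m - 1))} (hs₁ : IsRun j s₁)
        (hj : j + s₁.length = n + 1) (hs₂ : IsNormalWord n s₂) :
        (wordProd (s₁ ++ s₂) ⟨n + 1, by omega⟩).val = j := by
      rw [wordProd_append, Equiv.Perm.mul_apply,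
        wordProd_apply_of_forall_lt hs₂.lt n.lt_add_one, hs₁.val_wordProd_apply hj.symm]
    obtain ⟨j, s₁, s₂, hs₁, hj, hs₂, rfl⟩ := hs
    obtain ⟨j', t₁, t₂, ht₁, hj', ht₂, rfl⟩ := ht
    obtain rfl : j = j' := by rw [← start_eq hs₁ hj hs₂, h, start_eq ht₁ hj' ht₂]
    obtain rfl := hs₁.eq_of_length_eq ht₁ (by omega)
    rw [wordProd_append, wordProd_append, mul_right_inj] at h
    rw [ih (by omega) hs₂ ht₂ h]

/-- Matsumoto's theorem for the symmetric group, together with the fact that a word which is not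
reduced can be shortened after braid moves. -/
theorem braidEquiv_or_hasSquare {s t : List (Fin (m - 1))} {w : Equiv.Perm (Fin m)}
    (ht : IsMinimalPresentation t w) (hs : wordProd s = w) : BraidEquiv s t ∨ HasSquare s := by
  rcases exists_isNormalWord s with ⟨c, hc, h⟩ | h
  · rcases exists_isNormalWord t with ⟨c', hc', h'⟩ | h'
    · have hcc' : wordProd c = wordProd c' := by
        rw [← h.wordProd_eq, ← h'.wordProd_eq, hs, ht.1]
      exact .inl (h.trans (hc.eq_of_wordProd_eq le_rfl hc' hcc' ▸ h'.symm))
    · exact absurd h' ht.not_hasSquare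
  · exact .inr h

end SimpleTranspositions

section Positions

variable {m : ℕ} {k l : Fin (m - 1)}

theorem lpos_ne_rpos (k : Fin (m - 1)) : lpos k ≠ rpos k :=
  Fin.ne_of_val_ne k.val.succ_ne_self.symm

theorem simpleTr_lpos_of_far (h : k.val + 1 < l.val ∨ l.val + 1 < k.val) :
    simpleTr k (lpos l) = lpos l :=
  simpleTr_of_ne (Fin.ne_of_val_ne (by simp only [lpos]; omega))
    (Fin.ne_of_val_ne (by simp only [lpos, rpos]; omega))

theorem simpleTr_rpos_of_far (h : k.val + 1 < l.val ∨ l.val + 1 < k.val) :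
    simpleTr k (rpos l) = rpos l :=
  simpleTr_of_ne (Fin.ne_of_val_ne (by simp only [lpos, rpos]; omega))
    (Fin.ne_of_val_ne (by simp only [rpos]; omega))

theorem lpos_eq_rpos_of_succ (h : l.val = k.val + 1) : lpos l = rpos k := Fin.ext h

theorem lpos_ne_rpos_of_succ (h : l.val = k.val + 1) : lpos k ≠ rpos l :=
  Fin.ne_of_val_ne (by simp only [lpos, rpos]; omega)

theorem simpleTr_lpos_of_succ (h : l.val = k.val + 1) : simpleTr l (lpos k) = lpos k :=
  simpleTr_of_ne (lpos_eq_rpos_of_succ h ▸ lpos_ne_rpos k) (lpos_ne_rpos_of_succ h)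

theorem simpleTr_rpos_of_succ (h : l.val = k.val + 1) : simpleTr k (rpos l) = rpos l :=
  simpleTr_of_ne (lpos_ne_rpos_of_succ h).symm (lpos_eq_rpos_of_succ h ▸ (lpos_ne_rpos l).symm)

end Positions

namespace Seq

variable {I : Type*} {ν : I →₀ ℕ} {k l : Fin (len ν - 1)}

theorem perm_mul (v w : Equiv.Perm (Fin (len ν))) (i : Seq ν) :
    i.perm (v * w) = (i.perm w).perm v := rfl

theorem act_eq_perm (i : Seq ν) (s : List (Fin (len ν - 1))) : i.act s = i.perm (wordProd s) := by
  induction s with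
  | nil => rfl
  | cons k s ih => rw [wordProd_cons, perm_mul, ← ih]; rfl

theorem swap_vertex (k : Fin (len ν - 1)) (i : Seq ν) (a : Fin (len ν)) :
    (i.swap k).vertex a = i.vertex (simpleTr k a) := rfl

theorem swap_swap (k : Fin (len ν - 1)) (i : Seq ν) : (i.swap k).swap k = i :=
  congrArg i.perm (simpleTr_mul_self k)

theorem swap_comm (h : k.val + 1 < l.val) (i : Seq ν) :
    (i.swap l).swap k = (i.swap k).swap l :=
  congrArg i.perm (simpleTr_mul_simpleTr_of_far h)

theorem swap_braid (h : l.val = k.val + 1) (i : Seq ν) :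
    ((i.swap k).swap l).swap k = ((i.swap l).swap k).swap l :=
  congrArg i.perm (simpleTr_braid h)

theorem swap_eq_self {i : Seq ν} (h : i.vertex (lpos k) = i.vertex (rpos k)) : i.swap k = i := by
  ext a
  rw [swap_vertex, simpleTr, Equiv.swap_apply_def]
  split_ifs with hl hr
  · rw [hl, h]
  · rw [hr, h]
  · rfl

theorem swap_swap_swap_eq_self (hkl : l.val = k.val + 1) {i : Seq ν}
    (h : i.vertex (lpos k) = i.vertex (rpos l)) : ((i.swap l).swap k).swap l = i := by
  have hmid : (i.swap l).swap k = i.swap l := swap_eq_self (by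
    rw [swap_vertex, swap_vertex, simpleTr_lpos_of_succ hkl, ← lpos_eq_rpos_of_succ hkl,
      simpleTr_lpos, h])
  rw [hmid, swap_swap]

end Seq

section CommutingEval

variable {σ S A : Type*} [CommRing S] [Ring A] [Algebra S A] {y : σ → A}

theorem commute_of_mem_range (hy : ∀ a b, Commute (y a) (y b)) :
    ∀ a ∈ Set.range y, ∀ b ∈ Set.range y, a * b = b * a := by
  rintro _ ⟨a, rfl⟩ _ ⟨b, rfl⟩
  exact hy a b

open scoped IsMulCommutative in
/-- Evaluation of polynomials at a family of commuting elements of a ring which need not be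
commutative. -/
noncomputable def commutingEval (S : Type*) [CommRing S] [Algebra S A]
    (hy : ∀ a b, Commute (y a) (y b)) : MvPolynomial σ S →ₐ[S] A :=
  have := Algebra.isMulCommutative_adjoin S (commute_of_mem_range hy)
  (Algebra.adjoin S (Set.range y)).val.comp
    (MvPolynomial.aeval fun a => ⟨y a, Algebra.subset_adjoin ⟨a, rfl⟩⟩)

open scoped IsMulCommutative in
theorem commutingEval_X (hy : ∀ a b, Commute (y a) (y b)) (a : σ) :
    commutingEval S hy (MvPolynomial.X a) = y a := by
  have := Algebra.isMulCommutative_adjoin S (commute_of_mem_range hy)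
  simp [commutingEval]

theorem commute_commutingEval {c : A} (hy : ∀ a b, Commute (y a) (y b))
    (hc : ∀ a, Commute c (y a)) (p : MvPolynomial σ S) : Commute c (commutingEval S hy p) := by
  induction p using MvPolynomial.induction_on with
  | C a =>
    rw [MvPolynomial.algHom_C]
    exact Algebra.commute_algebraMap_right a c
  | add p q hp hq => rw [map_add]; exact hp.add_right hq
  | mul_X p a hp => rw [map_mul, commutingEval_X]; exact hp.mul_right (hc a)

end CommutingEval

/-! ### Spanning -/

section Relations

variable {I : Type*} {Γ : SimpleGraph I} {ν : I →₀ ℕ}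

theorem mk_rel {a b : FreeAlgebra ℤ (Gen ν)} (h : Rel Γ ν a b) : mk Γ ν a = mk Γ ν b :=
  RingQuot.mkRingHom_rel h

theorem R.induction {P : R Γ ν → Prop} (int : ∀ n : ℤ, P n) (he : ∀ i, P (e Γ i))
    (hx : ∀ k i, P (x Γ k i)) (hδ : ∀ k i, P (δ Γ k i)) (add : ∀ r s, P r → P s → P (r + s))
    (mul : ∀ r s, P r → P s → P (r * s)) (r : R Γ ν) : P r := by
  obtain ⟨a, rfl⟩ : ∃ a, mk Γ ν a = r := RingQuot.mkRingHom_surjective (Rel Γ ν) r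
  induction a using FreeAlgebra.induction with
  | grade0 n => simpa using int n
  | grade1 g =>
    cases g with
    | idem i => exact he i
    | dot k i => exact hx k i
    | cross k i => exact hδ k i
  | mul a b ha hb => rw [map_mul]; exact mul _ _ ha hb
  | add a b ha hb => rw [map_add]; exact add _ _ ha hb

theorem e_mul_self (i : Seq ν) : e Γ i * e Γ i = e Γ i := by
  simpa only [e, map_mul] using mk_rel (Rel.idem_mul_self (Γ := Γ) i)

theorem e_mul_ne {i j : Seq ν} (h : i ≠ j) : e Γ i * e Γ j = 0 := by
  simpa only [e, map_mul, map_zero] using mk_rel (Rel.idem_mul_ne (Γ := Γ) i j h)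

theorem sum_e : ∑ i : Seq ν, e Γ i = 1 := by
  simpa only [e, map_sum, map_one] using mk_rel (Rel.sum_idem (Γ := Γ) (ν := ν))

theorem x_mul_e (k : Fin (len ν)) (i : Seq ν) : x Γ k i * e Γ i = x Γ k i := by
  simpa only [x, e, map_mul] using mk_rel (Rel.dot_bot (Γ := Γ) k i)

theorem e_mul_x (k : Fin (len ν)) (i : Seq ν) : e Γ i * x Γ k i = x Γ k i := by
  simpa only [x, e, map_mul] using mk_rel (Rel.dot_top (Γ := Γ) k i)

theorem δ_mul_e (k : Fin (len ν - 1)) (i : Seq ν) : δ Γ k i * e Γ i = δ Γ k i := by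
  simpa only [δ, e, map_mul] using mk_rel (Rel.cross_bot (Γ := Γ) k i)

theorem e_mul_δ (k : Fin (len ν - 1)) (i : Seq ν) : e Γ (i.swap k) * δ Γ k i = δ Γ k i := by
  simpa only [δ, e, map_mul] using mk_rel (Rel.cross_top (Γ := Γ) k i)

theorem x_comm (i : Seq ν) (k l : Fin (len ν)) : Commute (x Γ k i) (x Γ l i) := by
  simpa only [x, map_mul, Commute, SemiconjBy] using mk_rel (Rel.dot_dot (Γ := Γ) k l i)

theorem δ_mul_x {k : Fin (len ν - 1)} {l : Fin (len ν)} (i : Seq ν) (hl : l ≠ lpos k)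
    (hr : l ≠ rpos k) : δ Γ k i * x Γ l i = x Γ l (i.swap k) * δ Γ k i := by
  simpa only [δ, x, map_mul] using mk_rel (Rel.cross_dot (Γ := Γ) k l i hl hr)

theorem δ_comm {k l : Fin (len ν - 1)} (i : Seq ν) (h : k.val + 1 < l.val) :
    δ Γ k (i.swap l) * δ Γ l i = δ Γ l (i.swap k) * δ Γ k i := by
  simpa only [δ, map_mul] using mk_rel (Rel.cross_cross (Γ := Γ) k l i h)

theorem δ_sq_eq {k : Fin (len ν - 1)} {i : Seq ν} (h : i.vertex (lpos k) = i.vertex (rpos k)) :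
    δ Γ k (i.swap k) * δ Γ k i = 0 := by
  simpa only [δ, map_mul, map_zero] using mk_rel (Rel.double_eq (Γ := Γ) k i h)

theorem δ_sq_far {k : Fin (len ν - 1)} {i : Seq ν} (hne : i.vertex (lpos k) ≠ i.vertex (rpos k))
    (h : ¬ Γ.Adj (i.vertex (lpos k)) (i.vertex (rpos k))) :
    δ Γ k (i.swap k) * δ Γ k i = e Γ i := by
  simpa only [δ, e, map_mul] using mk_rel (Rel.double_far (Γ := Γ) k i hne h)

theorem δ_sq_adj {k : Fin (len ν - 1)} {i : Seq ν}
    (h : Γ.Adj (i.vertex (lpos k)) (i.vertex (rpos k))) :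
    δ Γ k (i.swap k) * δ Γ k i = x Γ (lpos k) i + x Γ (rpos k) i := by
  simpa only [δ, x, map_mul, map_add] using mk_rel (Rel.double_adj (Γ := Γ) k i h)

theorem x_lpos_mul_δ (k : Fin (len ν - 1)) (i : Seq ν) :
    x Γ (lpos k) (i.swap k) * δ Γ k i = δ Γ k i * x Γ (rpos k) i ∨
    x Γ (lpos k) (i.swap k) * δ Γ k i = e Γ i + δ Γ k i * x Γ (rpos k) i := by
  by_cases h : i.vertex (lpos k) = i.vertex (rpos k)
  · right
    rw [← sub_eq_iff_eq_add]
    simpa only [δ, x, e, map_sub, map_mul] using mk_rel (Rel.slide_eq_left (Γ := Γ) k i h)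
  · left
    simpa only [δ, x, map_mul] using mk_rel (Rel.slide_ne_left (Γ := Γ) k i h)

theorem x_rpos_mul_δ (k : Fin (len ν - 1)) (i : Seq ν) :
    x Γ (rpos k) (i.swap k) * δ Γ k i = δ Γ k i * x Γ (lpos k) i ∨
    δ Γ k i * x Γ (lpos k) i = e Γ i + x Γ (rpos k) (i.swap k) * δ Γ k i := by
  by_cases h : i.vertex (lpos k) = i.vertex (rpos k)
  · right
    rw [← sub_eq_iff_eq_add]
    simpa only [δ, x, e, map_sub, map_mul] using mk_rel (Rel.slide_eq_right (Γ := Γ) k i h)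
  · left
    simpa only [δ, x, map_mul] using mk_rel (Rel.slide_ne_right (Γ := Γ) k i h)

theorem δ_braid {k l : Fin (len ν - 1)} (hkl : l.val = k.val + 1) (i : Seq ν) :
    δ Γ k ((i.swap k).swap l) * δ Γ l (i.swap k) * δ Γ k i -
        δ Γ l ((i.swap l).swap k) * δ Γ k (i.swap l) * δ Γ l i = 0 ∨
    δ Γ k ((i.swap k).swap l) * δ Γ l (i.swap k) * δ Γ k i -
        δ Γ l ((i.swap l).swap k) * δ Γ k (i.swap l) * δ Γ l i = e Γ i := by
  by_cases h : i.vertex (lpos k) = i.vertex (rpos l) ∧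
      Γ.Adj (i.vertex (lpos k)) (i.vertex (rpos k))
  · right
    simpa only [δ, e, map_sub, map_mul] using mk_rel (Rel.braid_hard (Γ := Γ) k l hkl i h.1 h.2)
  · left
    rw [sub_eq_zero]
    simpa only [δ, map_mul] using mk_rel (Rel.braid_easy (Γ := Γ) k l hkl i h)

end Relations

section Dots

variable {I : Type*} (Γ : SimpleGraph I) {ν : I →₀ ℕ}

/-- Evaluation of polynomials at the dots on the strands of the sequence `i`. -/
noncomputable def dotEval (i : Seq ν) : MvPolynomial (Fin (len ν)) ℤ →ₐ[ℤ] R Γ ν :=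
  commutingEval ℤ (x_comm i)

theorem dotEval_X (i : Seq ν) (k : Fin (len ν)) : dotEval Γ i (MvPolynomial.X k) = x Γ k i :=
  commutingEval_X (x_comm i) k

theorem dotEval_monomial (i : Seq ν) (u : Fin (len ν) →₀ ℕ) :
    dotEval Γ i (MvPolynomial.monomial u 1) = dotMonomial Γ i u := by
  have hu : (MvPolynomial.monomial u 1 : MvPolynomial (Fin (len ν)) ℤ) =
      (List.ofFn fun k => MvPolynomial.X k ^ u k).prod := by
    rw [List.prod_ofFn, MvPolynomial.monomial_eq, Finsupp.prod_fintype _ _ fun _ => pow_zero _,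
      MvPolynomial.C_1, one_mul]
  rw [hu, map_list_prod, List.map_ofFn, dotMonomial]
  simp only [Function.comp_def, map_pow, dotEval_X]

variable {Γ}

theorem e_commute_dotEval (i : Seq ν) (p : MvPolynomial (Fin (len ν)) ℤ) :
    Commute (e Γ i) (dotEval Γ i p) :=
  commute_commutingEval (x_comm i) (fun k => (e_mul_x k i).trans (x_mul_e k i).symm) p

end Dots

section Spanning

variable {I : Type*} {Γ : SimpleGraph I} {ν : I →₀ ℕ} {i : Seq ν} {n : ℕ}

theorem hat_cons (k : Fin (len ν - 1)) (l : List (Fin (len ν - 1))) (i : Seq ν) :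
    hat Γ (k :: l) i = δ Γ k (i.act l) * hat Γ l i := rfl

theorem e_mul_hat (l : List (Fin (len ν - 1))) (i : Seq ν) :
    e Γ (i.act l) * hat Γ l i = hat Γ l i := by
  cases l with
  | nil => exact e_mul_self i
  | cons k l => rw [hat_cons, ← mul_assoc]; exact congrArg (· * _) (e_mul_δ k (i.act l))

theorem hat_mul_e (l : List (Fin (len ν - 1))) (i : Seq ν) : hat Γ l i * e Γ i = hat Γ l i := by
  induction l with
  | nil => exact e_mul_self i
  | cons k l ih => rw [hat_cons, mul_assoc, ih]

variable (Γ) in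
/-- The span of the diagrams with bottom sequence `i` which consist of fewer than `n` crossings
on top of any number of dots. -/
noncomputable def lowSpan (i : Seq ν) (n : ℕ) : Submodule ℤ (R Γ ν) :=
  Submodule.span ℤ {r | ∃ l p, l.length < n ∧ r = hat Γ l i * dotEval Γ i p}

theorem hat_mul_dotEval_mem_lowSpan {l : List (Fin (len ν - 1))} (h : l.length < n)
    (p : MvPolynomial (Fin (len ν)) ℤ) : hat Γ l i * dotEval Γ i p ∈ lowSpan Γ i n :=
  Submodule.subset_span ⟨l, p, h, rfl⟩

theorem hat_mem_lowSpan {l : List (Fin (len ν - 1))} (h : l.length < n) :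
    hat Γ l i ∈ lowSpan Γ i n := by
  simpa only [map_one, mul_one] using hat_mul_dotEval_mem_lowSpan h 1

theorem lowSpan_mono (i : Seq ν) : Monotone (lowSpan Γ i) := fun _ _ h =>
  Submodule.span_mono fun _ ⟨l, p, hl, hr⟩ => ⟨l, p, hl.trans_le h, hr⟩

theorem mul_dotEval_mem_lowSpan {r : R Γ ν} (hr : r ∈ lowSpan Γ i n)
    (p : MvPolynomial (Fin (len ν)) ℤ) : r * dotEval Γ i p ∈ lowSpan Γ i n := by
  suffices lowSpan Γ i n ≤ (lowSpan Γ i n).comap (LinearMap.mulRight ℤ (dotEval Γ i p)) from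
    this hr
  refine Submodule.span_le.2 ?_
  rintro _ ⟨l, q, hl, rfl⟩
  change hat Γ l i * dotEval Γ i q * dotEval Γ i p ∈ lowSpan Γ i n
  rw [mul_assoc, ← map_mul]
  exact hat_mul_dotEval_mem_lowSpan hl _

theorem mul_mem_lowSpan {a : R Γ ν} {j : Seq ν} {n' : ℕ} (ha : a * e Γ j = a)
    (h : ∀ l, l.length < n → i.act l = j → a * hat Γ l i ∈ lowSpan Γ i n')
    {r : R Γ ν} (hr : r ∈ lowSpan Γ i n) : a * r ∈ lowSpan Γ i n' := by
  suffices lowSpan Γ i n ≤ (lowSpan Γ i n').comap (LinearMap.mulLeft ℤ a) from this hr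
  refine Submodule.span_le.2 ?_
  rintro _ ⟨l, p, hl, rfl⟩
  change a * (hat Γ l i * dotEval Γ i p) ∈ lowSpan Γ i n'
  rw [← mul_assoc]
  refine mul_dotEval_mem_lowSpan ?_ p
  by_cases hj : i.act l = j
  · exact h l hl hj
  · rw [← ha, ← e_mul_hat, mul_assoc, ← mul_assoc (e Γ j), e_mul_ne (Ne.symm hj), zero_mul,
      mul_zero]
    exact zero_mem _

theorem e_mul_mem_lowSpan (j : Seq ν) {r : R Γ ν} (hr : r ∈ lowSpan Γ i n) :
    e Γ j * r ∈ lowSpan Γ i n :=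
  mul_mem_lowSpan (e_mul_self j) (fun l hl hj => by
    rw [← hj, e_mul_hat]; exact hat_mem_lowSpan hl) hr

theorem δ_mul_mem_lowSpan (k : Fin (len ν - 1)) (j : Seq ν) {r : R Γ ν}
    (hr : r ∈ lowSpan Γ i n) : δ Γ k j * r ∈ lowSpan Γ i (n + 1) :=
  mul_mem_lowSpan (δ_mul_e k j) (fun l hl hj => by
    rw [← hj, ← hat_cons]; exact hat_mem_lowSpan (Nat.succ_lt_succ hl)) hr

theorem x_mul_hat_mem_lowSpan (k : Fin (len ν)) (l : List (Fin (len ν - 1))) (i : Seq ν) :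
    x Γ k (i.act l) * hat Γ l i ∈ lowSpan Γ i (l.length + 1) := by
  induction l generalizing k with
  | nil =>
    change x Γ k i * e Γ i ∈ _
    rw [x_mul_e, ← e_mul_x, ← dotEval_X]
    exact hat_mul_dotEval_mem_lowSpan (l := []) zero_lt_one _
  | cons c l ih =>
    have below (k' : Fin (len ν)) :
        δ Γ c (i.act l) * x Γ k' (i.act l) * hat Γ l i ∈ lowSpan Γ i (l.length + 1 + 1) := by
      rw [mul_assoc]
      exact δ_mul_mem_lowSpan _ _ (ih k')
    have removed : e Γ (i.act l) * hat Γ l i ∈ lowSpan Γ i (l.length + 1 + 1) := by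
      rw [e_mul_hat]
      exact hat_mem_lowSpan (by omega)
    rw [hat_cons, ← mul_assoc]
    change x Γ k ((i.act l).swap c) * δ Γ c (i.act l) * hat Γ l i ∈ _
    by_cases hl : k = lpos c
    · subst hl
      rcases x_lpos_mul_δ (Γ := Γ) c (i.act l) with h | h <;> rw [h]
      · exact below _
      · rw [add_mul]; exact add_mem removed (below _)
    by_cases hr : k = rpos c
    · subst hr
      rcases x_rpos_mul_δ (Γ := Γ) c (i.act l) with h | h
      · rw [h]; exact below _
      · rw [eq_sub_of_add_eq' h.symm, sub_mul]; exact sub_mem (below _) removed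
    · rw [← δ_mul_x _ hl hr]; exact below _

theorem x_mul_mem_lowSpan (k : Fin (len ν)) (j : Seq ν) {r : R Γ ν}
    (hr : r ∈ lowSpan Γ i n) : x Γ k j * r ∈ lowSpan Γ i n :=
  mul_mem_lowSpan (x_mul_e k j) (fun l hl hj => by
    rw [← hj]; exact lowSpan_mono i hl (x_mul_hat_mem_lowSpan k l i)) hr

theorem BraidEquiv.hat_sub_hat_mem_lowSpan {l l' : List (Fin (len ν - 1))} (h : BraidEquiv l l')
    (i : Seq ν) : hat Γ l i - hat Γ l' i ∈ lowSpan Γ i l.length := by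
  induction h with
  | refl => rw [sub_self]; exact zero_mem _
  | symm h ih => rw [← h.length_eq, ← neg_sub]; exact neg_mem ih
  | trans h _ ih ih' =>
    rw [← h.length_eq] at ih'
    simpa only [sub_add_sub_cancel] using add_mem ih ih'
  | cons k h ih =>
    rw [hat_cons, hat_cons, Seq.act_eq_perm, Seq.act_eq_perm, ← h.wordProd_eq, ← mul_sub]
    exact δ_mul_mem_lowSpan _ _ ih
  | far a b l h =>
    simp only [hat_cons, ← mul_assoc]
    change δ Γ a ((i.act l).swap b) * δ Γ b (i.act l) * _ -
      δ Γ b ((i.act l).swap a) * δ Γ a (i.act l) * _ ∈ _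
    rw [δ_comm _ h, sub_self]
    exact zero_mem _
  | braid a b l h =>
    simp only [hat_cons, ← mul_assoc]
    change δ Γ a (((i.act l).swap a).swap b) * δ Γ b ((i.act l).swap a) * δ Γ a (i.act l) * _ -
      δ Γ b (((i.act l).swap b).swap a) * δ Γ a ((i.act l).swap b) * δ Γ b (i.act l) * _ ∈ _
    rw [← sub_mul]
    rcases δ_braid (Γ := Γ) h (i.act l) with h | h <;> rw [h]
    · rw [zero_mul]; exact zero_mem _
    · rw [e_mul_hat]; exact hat_mem_lowSpan (by simp only [List.length_cons]; omega)

theorem hat_append_mem_lowSpan {l : List (Fin (len ν - 1))} (a : List (Fin (len ν - 1)))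
    (h : hat Γ l i ∈ lowSpan Γ i n) : hat Γ (a ++ l) i ∈ lowSpan Γ i (a.length + n) := by
  induction a with
  | nil => simpa using h
  | cons k a ih =>
    rw [List.cons_append, hat_cons, List.length_cons, add_right_comm]
    exact δ_mul_mem_lowSpan _ _ ih

theorem δ_sq_mul_mem_lowSpan (k : Fin (len ν - 1)) (j : Seq ν) {r : R Γ ν}
    (hr : r ∈ lowSpan Γ i n) : δ Γ k (j.swap k) * δ Γ k j * r ∈ lowSpan Γ i n := by
  by_cases heq : j.vertex (lpos k) = j.vertex (rpos k)
  · rw [δ_sq_eq heq, zero_mul]; exact zero_mem _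
  by_cases hadj : Γ.Adj (j.vertex (lpos k)) (j.vertex (rpos k))
  · rw [δ_sq_adj hadj, add_mul]
    exact add_mem (x_mul_mem_lowSpan _ _ hr) (x_mul_mem_lowSpan _ _ hr)
  · rw [δ_sq_far heq hadj]; exact e_mul_mem_lowSpan _ hr

theorem HasSquare.hat_mem_lowSpan {l : List (Fin (len ν - 1))} (h : HasSquare l) (i : Seq ν) :
    hat Γ l i ∈ lowSpan Γ i l.length := by
  obtain ⟨a, s, b, h⟩ := h
  have double : hat Γ (s :: s :: b) i ∈ lowSpan Γ i (b.length + 1) := by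
    rw [hat_cons, hat_cons, ← mul_assoc]
    exact δ_sq_mul_mem_lowSpan s _ (KL.hat_mem_lowSpan b.length.lt_succ_self)
  have hlen : a.length + (b.length + 1) ≤ l.length := by
    rw [h.length_eq]
    simp only [List.length_append, List.length_cons]
    omega
  simpa only [sub_add_cancel] using add_mem (h.hat_sub_hat_mem_lowSpan i)
    (lowSpan_mono i hlen (hat_append_mem_lowSpan a double))

variable (Γ) in
/-- The span of the elements `ŵ_i p`, where `p` is a polynomial in the dots on the sequence `i`
and `ŵ_i` is formed by means of the presentations `word`. -/
noncomputable def wordSpan (word : Equiv.Perm (Fin (len ν)) → List (Fin (len ν - 1)))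
    (i : Seq ν) : Submodule ℤ (R Γ ν) :=
  Submodule.span ℤ {r | ∃ w p, r = hat Γ (word w) i * dotEval Γ i p}

variable {word : Equiv.Perm (Fin (len ν)) → List (Fin (len ν - 1))}

theorem lowSpan_le_wordSpan (hword : ∀ w, IsMinimalPresentation (word w) w) (i : Seq ν) (n : ℕ) :
    lowSpan Γ i n ≤ wordSpan Γ word i := by
  induction n with
  | zero => exact Submodule.span_le.2 fun r ⟨_, _, h, _⟩ => absurd h (Nat.not_lt_zero _)
  | succ n ih =>
    refine Submodule.span_le.2 ?_
    rintro r ⟨l, p, hl, rfl⟩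
    have lower {r : R Γ ν} (hr : r ∈ lowSpan Γ i l.length) :
        r * dotEval Γ i p ∈ wordSpan Γ word i :=
      ih (mul_dotEval_mem_lowSpan (lowSpan_mono i (Nat.lt_succ_iff.1 hl) hr) p)
    rw [SetLike.mem_coe]
    rcases braidEquiv_or_hasSquare (hword (wordProd l)) rfl with h | h
    · rw [← sub_add_cancel (hat Γ l i), add_mul]
      exact add_mem (lower (h.hat_sub_hat_mem_lowSpan i))
        (Submodule.subset_span ⟨wordProd l, p, rfl⟩)
    · exact lower (h.hat_mem_lowSpan i)

theorem wordSpan_le_comap_mulLeft (hword : ∀ w, IsMinimalPresentation (word w) w) (i : Seq ν)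
    (a : R Γ ν) : wordSpan Γ word i ≤ (wordSpan Γ word i).comap (LinearMap.mulLeft ℤ a) := by
  have of_low (b : R Γ ν) (h : ∀ n, ∀ r ∈ lowSpan Γ i n, b * r ∈ lowSpan Γ i (n + 1)) :
      wordSpan Γ word i ≤ (wordSpan Γ word i).comap (LinearMap.mulLeft ℤ b) := by
    refine Submodule.span_le.2 ?_
    rintro _ ⟨w, p, rfl⟩
    exact lowSpan_le_wordSpan hword i _
      (h _ _ (hat_mul_dotEval_mem_lowSpan (word w).length.lt_succ_self p))
  induction a using R.induction with
  | int m =>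
    refine of_low _ fun n r hr => ?_
    rw [← zsmul_eq_mul]
    exact Submodule.smul_mem _ m (lowSpan_mono i n.le_succ hr)
  | he j => exact of_low _ fun n r hr => lowSpan_mono i n.le_succ (e_mul_mem_lowSpan j hr)
  | hx k j => exact of_low _ fun n r hr => lowSpan_mono i n.le_succ (x_mul_mem_lowSpan k j hr)
  | hδ k j => exact of_low _ fun n r hr => δ_mul_mem_lowSpan k j hr
  | add a b ha hb =>
    intro r hr
    rw [Submodule.mem_comap, LinearMap.mulLeft_apply, add_mul]
    exact add_mem (ha hr) (hb hr)
  | mul a b ha hb =>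
    intro r hr
    rw [Submodule.mem_comap, LinearMap.mulLeft_apply, mul_assoc]
    exact ha (hb hr)

theorem mul_e_mem_wordSpan (hword : ∀ w, IsMinimalPresentation (word w) w) (i : Seq ν)
    (a : R Γ ν) : a * e Γ i ∈ wordSpan Γ word i :=
  wordSpan_le_comap_mulLeft hword i a
    (lowSpan_le_wordSpan hword i 1 (hat_mem_lowSpan (l := []) zero_lt_one))

end Spanning

open MvPolynomial

/-! ### Polynomials and rational functions -/

section DividedDifference

variable {σ A : Type*} [CommRing A]

theorem mulLeft_X_sub_X_injective [IsDomain A] {a b : σ} (h : a ≠ b) :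
    Function.Injective (LinearMap.mulLeft A (X a - X b : MvPolynomial σ A)) :=
  mul_right_injective₀ (sub_ne_zero.2 (X_injective.ne h))

variable [DecidableEq σ]

theorem X_sub_X_dvd_sub_rename_swap (a b : σ) (f : MvPolynomial σ A) :
    X a - X b ∣ f - rename (Equiv.swap a b) f := by
  rw [← Ideal.mem_span_singleton, ← Ideal.Quotient.mk_eq_mk_iff_sub_mem]
  set J := Ideal.span {(X a - X b : MvPolynomial σ A)}
  have hab : Ideal.Quotient.mk J (X a) = Ideal.Quotient.mk J (X b) :=
    (Ideal.Quotient.mk_eq_mk_iff_sub_mem _ _).2 (Ideal.mem_span_singleton_self _)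
  have : Ideal.Quotient.mkₐ A J = (Ideal.Quotient.mkₐ A J).comp (rename (Equiv.swap a b)) := by
    refine algHom_ext fun c => ?_
    rw [AlgHom.comp_apply, rename_X, Equiv.swap_apply_def]
    split_ifs with ha hb
    · rw [ha]; exact hab
    · rw [hb]; exact hab.symm
    · rfl
  exact DFunLike.congr_fun this f

variable {a b : σ} [IsDomain A]

/-- The divided difference operator `f ↦ (f - s f) / (x_a - x_b)`, where `s` exchanges the
variables `x_a` and `x_b`. -/
noncomputable def divDiff (h : a ≠ b) : Module.End A (MvPolynomial σ A) :=
  (LinearEquiv.ofInjective _ (mulLeft_X_sub_X_injective h)).symm.toLinearMap ∘ₗ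
    LinearMap.codRestrict _ (LinearMap.id - (rename (Equiv.swap a b)).toLinearMap) fun f =>
      let ⟨g, hg⟩ := X_sub_X_dvd_sub_rename_swap a b f
      ⟨g, by simpa using hg.symm⟩

theorem mul_divDiff (h : a ≠ b) (f : MvPolynomial σ A) :
    (X a - X b) * divDiff h f = f - rename (Equiv.swap a b) f :=
  congrArg Subtype.val <| LinearEquiv.apply_symm_apply
    (LinearEquiv.ofInjective (LinearMap.mulLeft A (X a - X b)) (mulLeft_X_sub_X_injective h)) _

end DividedDifference

section RationalFunctions

variable {σ : Type*}

/-- The field of rational functions in the variables `x_a`, `a ∈ σ`. -/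
abbrev RatField (σ : Type*) : Type _ := FractionRing (MvPolynomial σ ℤ)

/-- The inclusion of the polynomials into the rational functions. -/
noncomputable abbrev toRat : MvPolynomial σ ℤ →+* RatField σ := algebraMap _ _

theorem toRat_injective : Function.Injective (toRat (σ := σ)) := IsFractionRing.injective _ _

/-- The variable `x_a` as a rational function. -/
noncomputable def ratX (a : σ) : RatField σ := toRat (X a)

theorem toRat_X (a : σ) : toRat (X a) = ratX a := rfl

theorem ratX_injective : Function.Injective (ratX (σ := σ)) :=
  toRat_injective.comp X_injective

theorem ratX_sub_ne_zero {a b : σ} (h : a ≠ b) : ratX a - ratX b ≠ 0 :=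
  sub_ne_zero.2 (ratX_injective.ne h)

theorem ratX_add_ne_zero (a b : σ) : ratX a + ratX b ≠ 0 := by
  rw [ratX, ratX, ← map_add, map_ne_zero_iff _ toRat_injective]
  intro h
  simpa using congrArg (eval fun _ => (1 : ℤ)) h

theorem RatField.ringHom_ext {f g : RatField σ →+* RatField σ}
    (h : ∀ a, f (ratX a) = g (ratX a)) : f = g :=
  IsLocalization.ringHom_ext (nonZeroDivisors (MvPolynomial σ ℤ))
    (MvPolynomial.ringHom_ext (fun _ => by simp) h)

theorem ringEquivOfRingEquiv_ratX (w : Equiv.Perm σ) (a : σ) :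
    IsFractionRing.ringEquivOfRingEquiv (K := RatField σ) (L := RatField σ)
      (renameEquiv ℤ w).toRingEquiv (ratX a) = ratX (w a) := by
  simp [ratX]

/-- The action of the permutations of the variables on rational functions. -/
noncomputable def ratPerm : Equiv.Perm σ →* (RatField σ →+* RatField σ) where
  toFun w := (IsFractionRing.ringEquivOfRingEquiv (renameEquiv ℤ w).toRingEquiv).toRingHom
  map_one' := RatField.ringHom_ext fun a => ringEquivOfRingEquiv_ratX 1 a
  map_mul' v w := RatField.ringHom_ext fun a => by
    simp only [RingHom.mul_def, RingHom.comp_apply, RingEquiv.toRingHom_eq_coe, RingHom.coe_coe,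
      ringEquivOfRingEquiv_ratX, Equiv.Perm.mul_apply]

theorem ratPerm_ratX (w : Equiv.Perm σ) (a : σ) : ratPerm w (ratX a) = ratX (w a) :=
  ringEquivOfRingEquiv_ratX w a

theorem ratPerm_toRat (w : Equiv.Perm σ) (f : MvPolynomial σ ℤ) :
    ratPerm w (toRat f) = toRat (rename w f) :=
  IsFractionRing.ringEquivOfRingEquiv_algebraMap _ f

theorem ratPerm_ratPerm (v w : Equiv.Perm σ) (f : RatField σ) :
    ratPerm v (ratPerm w f) = ratPerm (v * w) f := by rw [map_mul, RingHom.mul_def]; rfl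

theorem ratPerm_one (f : RatField σ) : ratPerm 1 f = f := by rw [map_one, RingHom.one_def]; rfl

end RationalFunctions

/-! ### The action on polynomials -/

section CrossFormula

variable {I K : Type*} {Γ : SimpleGraph I} (o : Orientation Γ) [Field K]

theorem Orientation.not_arrow_self (p : I) : ¬ o.arrow p p := fun h => o.asymm p p h h

open Classical in
/-- The factor by which a crossing of strands labelled `p ≠ q` differs from the exchange of the
variables `a`, `b`. -/
noncomputable def edgeFactor (p q : I) (a b : K) : K :=
  if o.arrow p q then a + b else 1

open Classical in
/-- The action of a crossing of strands labelled `p`, `q` on a function with value `g`, where `g'`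
is the value of the function obtained by exchanging the variables `a`, `b`. Treating `g` and `g'`
as independent quantities turns the relations between crossings into identities of rational
expressions. -/
noncomputable def crossFormula (p q : I) (a b g g' : K) : K :=
  if p = q then (g - g') / (a - b) else edgeFactor o p q a b * g'

theorem edgeFactor_comm (p q : I) (a b : K) : edgeFactor o p q a b = edgeFactor o p q b a := by
  rw [edgeFactor, edgeFactor, add_comm]

theorem edgeFactor_ne_zero {p q : I} {a b : K} (h : a + b ≠ 0) : edgeFactor o p q a b ≠ 0 := by
  rw [edgeFactor]
  split_ifs
  exacts [h, one_ne_zero]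

theorem edgeFactor_mul_of_adj {p q : I} (h : Γ.Adj p q) (a b : K) :
    edgeFactor o p q a b * edgeFactor o q p a b = a + b := by
  rcases (o.adj_iff p q).1 h with h | h <;> simp [edgeFactor, h, o.asymm _ _ h]

theorem edgeFactor_of_not_adj {p q : I} (h : ¬ Γ.Adj p q) (a b : K) :
    edgeFactor o p q a b = 1 :=
  if_neg fun harrow => h ((o.adj_iff p q).2 (.inl harrow))

theorem crossFormula_self (p : I) (a b g g' : K) :
    crossFormula o p p a b g g' = (g - g') / (a - b) :=
  if_pos rfl

theorem crossFormula_of_ne {p q : I} (h : p ≠ q) (a b g g' : K) :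
    crossFormula o p q a b g g' = edgeFactor o p q a b * g' :=
  if_neg h

theorem map_crossFormula {L : Type*} [Field L] (φ : K →+* L) (p q : I) (a b g g' : K) :
    φ (crossFormula o p q a b g g') = crossFormula o p q (φ a) (φ b) (φ g) (φ g') := by
  unfold crossFormula edgeFactor
  split_ifs <;> simp only [map_div₀, map_sub, map_mul, map_add, map_one]

theorem crossFormula_crossFormula_self (p : I) (a b g g' : K) :
    crossFormula o p p a b (crossFormula o p p a b g g') (crossFormula o p p b a g' g) = 0 := by
  rw [crossFormula_self, crossFormula_self, crossFormula_self, ← neg_sub g, ← neg_sub a,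
    neg_div_neg_eq, sub_self, zero_div]

theorem crossFormula_crossFormula_of_ne {p q : I} (h : p ≠ q) (a b g g' : K) :
    crossFormula o q p a b (crossFormula o p q a b g g') (crossFormula o p q b a g' g) =
      edgeFactor o p q a b * edgeFactor o q p a b * g := by
  rw [crossFormula_of_ne o h, crossFormula_of_ne o h, crossFormula_of_ne o h.symm,
    edgeFactor_comm o p q b a]
  ring

theorem crossFormula_comm (p q r s : I) (a b c d g g₁ g₂ g₁₂ : K) :
    crossFormula o p q a b (crossFormula o r s c d g g₂) (crossFormula o r s c d g₁ g₁₂) =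
      crossFormula o r s c d (crossFormula o p q a b g g₁) (crossFormula o p q a b g₂ g₁₂) := by
  unfold crossFormula
  split_ifs <;> ring

open Classical in
theorem crossFormula_braid_self {p q : I} (h : p ≠ q) {a b c : K} (hac : a - c ≠ 0)
    (g g₁ g₂ g₁₂ g₂₁ g₀ : K) :
    crossFormula o q p a b
        (crossFormula o p p b c (crossFormula o p q a b g g₁) (crossFormula o p q a c g₂ g₂₁))
        (crossFormula o p p a c (crossFormula o p q b a g₁ g) (crossFormula o p q b c g₁₂ g₀)) -
      crossFormula o p q b c
        (crossFormula o p p a b (crossFormula o q p b c g g₂) (crossFormula o q p a c g₁ g₁₂))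
        (crossFormula o p p a c (crossFormula o q p c b g₂ g) (crossFormula o q p a b g₂₁ g₀)) =
      if Γ.Adj p q then g else 0 := by
  simp only [crossFormula_self, crossFormula_of_ne o h, crossFormula_of_ne o h.symm]
  split_ifs with hadj
  · rcases (o.adj_iff p q).1 hadj with h | h <;>
    · simp only [edgeFactor, h, o.asymm _ _ h, if_true, if_false]
      field_simp
      ring
  · simp only [edgeFactor_of_not_adj o hadj, edgeFactor_of_not_adj o (mt Γ.adj_symm hadj)]
    ring

open Classical in
/-- The functions `g₁`, `g₂`, `g₁₂`, `g₂₁`, `g₀` are obtained from `g` by the permutations `s₁`,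
`s₂`, `s₁s₂`, `s₂s₁`, `s₁s₂s₁` of the variables `a`, `b`, `c`. -/
theorem crossFormula_braid (p q r : I) {a b c : K} (hab : a - b ≠ 0) (hac : a - c ≠ 0)
    (hbc : b - c ≠ 0) (g g₁ g₂ g₁₂ g₂₁ g₀ : K) :
    crossFormula o q r a b
        (crossFormula o p r b c (crossFormula o p q a b g g₁) (crossFormula o p q a c g₂ g₂₁))
        (crossFormula o p r a c (crossFormula o p q b a g₁ g) (crossFormula o p q b c g₁₂ g₀)) -
      crossFormula o p q b c
        (crossFormula o p r a b (crossFormula o q r b c g g₂) (crossFormula o q r a c g₁ g₁₂))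
        (crossFormula o p r a c (crossFormula o q r c b g₂ g) (crossFormula o q r a b g₂₁ g₀)) =
      if p = r ∧ Γ.Adj p q then g else 0 := by
  by_cases hpr : p = r
  · subst hpr
    simp only [true_and]
    by_cases hpq : p = q
    · subst hpq
      have hba : b - a ≠ 0 := by rwa [← neg_sub, neg_ne_zero]
      have hcb : c - b ≠ 0 := by rwa [← neg_sub, neg_ne_zero]
      simp only [crossFormula_self, Γ.irrefl, if_false]
      field_simp
      ring
    · exact crossFormula_braid_self o hpq hac ..
  · rw [if_neg fun h => hpr h.1, crossFormula_of_ne o hpr, crossFormula_of_ne o hpr,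
      crossFormula_of_ne o hpr, crossFormula_of_ne o hpr]
    unfold crossFormula
    split_ifs with hqr hpq hpq
    · exact absurd (hpq.trans hqr) hpr
    all_goals subst_vars; ring

end CrossFormula

section CrossOp

variable {I : Type*} {Γ : SimpleGraph I} {ν : I →₀ ℕ} (o : Orientation Γ)
  {k l : Fin (len ν - 1)} {i : Seq ν}

open Classical in
/-- The action of the crossing `δ_{k,i}` on polynomials. -/
noncomputable def crossOp (k : Fin (len ν - 1)) (i : Seq ν) :
    Module.End ℤ (MvPolynomial (Fin (len ν)) ℤ) :=
  if i.vertex (lpos k) = i.vertex (rpos k) then divDiff (lpos_ne_rpos k)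
  else if o.arrow (i.vertex (lpos k)) (i.vertex (rpos k)) then
    LinearMap.mulLeft ℤ (X (lpos k) + X (rpos k)) ∘ₗ (rename (simpleTr k)).toLinearMap
  else (rename (simpleTr k)).toLinearMap

theorem mul_crossOp_of_eq (h : i.vertex (lpos k) = i.vertex (rpos k))
    (f : MvPolynomial (Fin (len ν)) ℤ) :
    (X (lpos k) - X (rpos k)) * crossOp o k i f = f - sPol k f := by
  rw [crossOp, if_pos h, mul_divDiff]
  rfl

theorem crossOp_of_not_arrow (h : i.vertex (lpos k) ≠ i.vertex (rpos k))
    (h' : ¬ o.arrow (i.vertex (lpos k)) (i.vertex (rpos k))) (f : MvPolynomial (Fin (len ν)) ℤ) :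
    crossOp o k i f = sPol k f := by
  rw [crossOp, if_neg h, if_neg h']
  rfl

theorem crossOp_of_arrow (h : o.arrow (i.vertex (lpos k)) (i.vertex (rpos k)))
    (f : MvPolynomial (Fin (len ν)) ℤ) :
    crossOp o k i f = (X (lpos k) + X (rpos k)) * sPol k f := by
  rw [crossOp, if_neg fun heq => o.not_arrow_self _ (heq ▸ h), if_pos h]
  rfl

theorem toRat_crossOp (k : Fin (len ν - 1)) (i : Seq ν) (f : MvPolynomial (Fin (len ν)) ℤ) :
    toRat (crossOp o k i f) =
      crossFormula o (i.vertex (lpos k)) (i.vertex (rpos k)) (ratX (lpos k)) (ratX (rpos k))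
        (toRat f) (ratPerm (simpleTr k) (toRat f)) := by
  rw [ratPerm_toRat, crossFormula, edgeFactor]
  split_ifs with heq harrow
  · rw [eq_div_iff (ratX_sub_ne_zero (lpos_ne_rpos k)), ← toRat_X, ← toRat_X, ← map_sub,
      ← map_sub, ← map_mul, mul_comm, mul_crossOp_of_eq o heq, sPol]
  · rw [crossOp_of_arrow o harrow, map_mul, map_add, sPol, toRat_X, toRat_X]
  · rw [crossOp_of_not_arrow o heq harrow, one_mul, sPol]

theorem toRat_crossOp_crossOp (k : Fin (len ν - 1)) (i : Seq ν)
    (f : MvPolynomial (Fin (len ν)) ℤ) :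
    toRat (crossOp o k (i.swap k) (crossOp o k i f)) =
      crossFormula o (i.vertex (rpos k)) (i.vertex (lpos k)) (ratX (lpos k)) (ratX (rpos k))
        (crossFormula o (i.vertex (lpos k)) (i.vertex (rpos k)) (ratX (lpos k)) (ratX (rpos k))
          (toRat f) (ratPerm (simpleTr k) (toRat f)))
        (crossFormula o (i.vertex (lpos k)) (i.vertex (rpos k)) (ratX (rpos k)) (ratX (lpos k))
          (ratPerm (simpleTr k) (toRat f)) (toRat f)) := by
  simp only [toRat_crossOp, map_crossFormula, ratPerm_ratX, Seq.swap_vertex, simpleTr_lpos,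
    simpleTr_rpos, ratPerm_ratPerm, simpleTr_mul_self, ratPerm_one]

theorem crossOp_sq_eq (h : i.vertex (lpos k) = i.vertex (rpos k)) :
    crossOp o k (i.swap k) * crossOp o k i = 0 := by
  refine LinearMap.ext fun f => toRat_injective ?_
  rw [Module.End.mul_apply, toRat_crossOp_crossOp, h, crossFormula_crossFormula_self,
    LinearMap.zero_apply, map_zero]

theorem crossOp_sq_far (hne : i.vertex (lpos k) ≠ i.vertex (rpos k))
    (h : ¬ Γ.Adj (i.vertex (lpos k)) (i.vertex (rpos k))) :
    crossOp o k (i.swap k) * crossOp o k i = 1 := by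
  refine LinearMap.ext fun f => toRat_injective ?_
  rw [Module.End.mul_apply, toRat_crossOp_crossOp, crossFormula_crossFormula_of_ne o hne,
    edgeFactor_of_not_adj o h, edgeFactor_of_not_adj o (mt Γ.adj_symm h), one_mul, one_mul,
    Module.End.one_apply]

theorem crossOp_sq_adj (h : Γ.Adj (i.vertex (lpos k)) (i.vertex (rpos k))) :
    crossOp o k (i.swap k) * crossOp o k i =
      LinearMap.mulLeft ℤ (X (lpos k)) + LinearMap.mulLeft ℤ (X (rpos k)) := by
  refine LinearMap.ext fun f => toRat_injective ?_
  rw [Module.End.mul_apply, toRat_crossOp_crossOp, crossFormula_crossFormula_of_ne o h.ne,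
    edgeFactor_mul_of_adj o h, add_mul, LinearMap.add_apply, map_add, LinearMap.mulLeft_apply,
    LinearMap.mulLeft_apply, map_mul, map_mul, toRat_X, toRat_X]

theorem crossOp_mul_X {a : Fin (len ν)} (i : Seq ν) (hl : a ≠ lpos k) (hr : a ≠ rpos k) :
    crossOp o k i * LinearMap.mulLeft ℤ (X a) = LinearMap.mulLeft ℤ (X a) * crossOp o k i := by
  refine LinearMap.ext fun f => toRat_injective ?_
  simp only [Module.End.mul_apply, LinearMap.mulLeft_apply, map_mul, toRat_crossOp, toRat_X,
    ratPerm_ratX, simpleTr_of_ne hl hr]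
  unfold crossFormula
  split_ifs <;> ring

theorem X_mul_crossOp_of_ne (h : i.vertex (lpos k) ≠ i.vertex (rpos k)) (a : Fin (len ν)) :
    LinearMap.mulLeft ℤ (X (simpleTr k a)) * crossOp o k i =
      crossOp o k i * LinearMap.mulLeft ℤ (X a) := by
  refine LinearMap.ext fun f => toRat_injective ?_
  simp only [Module.End.mul_apply, LinearMap.mulLeft_apply, map_mul, toRat_crossOp, toRat_X,
    ratPerm_ratX, crossFormula_of_ne o h]
  ring

theorem X_lpos_mul_crossOp_of_eq (h : i.vertex (lpos k) = i.vertex (rpos k)) :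
    LinearMap.mulLeft ℤ (X (lpos k)) * crossOp o k i -
      crossOp o k i * LinearMap.mulLeft ℤ (X (rpos k)) = 1 := by
  refine LinearMap.ext fun f => toRat_injective ?_
  have hne := ratX_sub_ne_zero (lpos_ne_rpos k)
  simp only [Module.End.mul_apply, LinearMap.mulLeft_apply, LinearMap.sub_apply, map_sub, map_mul,
    Module.End.one_apply, toRat_crossOp, toRat_X, ratPerm_ratX, h, crossFormula_self, simpleTr_rpos]
  field_simp
  ring

theorem crossOp_mul_X_lpos_of_eq (h : i.vertex (lpos k) = i.vertex (rpos k)) :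
    crossOp o k i * LinearMap.mulLeft ℤ (X (lpos k)) -
      LinearMap.mulLeft ℤ (X (rpos k)) * crossOp o k i = 1 := by
  refine LinearMap.ext fun f => toRat_injective ?_
  have hne := ratX_sub_ne_zero (lpos_ne_rpos k)
  simp only [Module.End.mul_apply, LinearMap.mulLeft_apply, LinearMap.sub_apply, map_sub, map_mul,
    Module.End.one_apply, toRat_crossOp, toRat_X, ratPerm_ratX, h, crossFormula_self, simpleTr_lpos]
  field_simp
  ring

theorem crossOp_comm (h : k.val + 1 < l.val) (i : Seq ν) :
    crossOp o k (i.swap l) * crossOp o l i = crossOp o l (i.swap k) * crossOp o k i := by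
  refine LinearMap.ext fun f => toRat_injective ?_
  simp only [Module.End.mul_apply, toRat_crossOp, map_crossFormula, ratPerm_ratX, Seq.swap_vertex,
    ratPerm_ratPerm, simpleTr_lpos_of_far (.inl h), simpleTr_rpos_of_far (.inl h),
    simpleTr_lpos_of_far (.inr h), simpleTr_rpos_of_far (.inr h),
    simpleTr_mul_simpleTr_of_far h]
  exact crossFormula_comm o ..

open Classical in
theorem crossOp_braid (h : l.val = k.val + 1) (i : Seq ν) :
    crossOp o k ((i.swap k).swap l) * crossOp o l (i.swap k) * crossOp o k i -
        crossOp o l ((i.swap l).swap k) * crossOp o k (i.swap l) * crossOp o l i =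
      if i.vertex (lpos k) = i.vertex (rpos l) ∧ Γ.Adj (i.vertex (lpos k)) (i.vertex (rpos k))
      then 1 else 0 := by
  have hl := lpos_eq_rpos_of_succ h
  have hlr : simpleTr l (rpos k) = rpos l := hl ▸ simpleTr_lpos l
  have hrl : simpleTr l (rpos l) = rpos k := hl ▸ simpleTr_rpos l
  refine LinearMap.ext fun f => toRat_injective ?_
  have key := crossFormula_braid o (i.vertex (lpos k)) (i.vertex (rpos k)) (i.vertex (rpos l))
    (ratX_sub_ne_zero (lpos_ne_rpos k)) (ratX_sub_ne_zero (lpos_ne_rpos_of_succ h))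
    (ratX_sub_ne_zero (hl ▸ lpos_ne_rpos l))
    (toRat f) (ratPerm (simpleTr k) (toRat f)) (ratPerm (simpleTr l) (toRat f))
    (ratPerm (simpleTr k * simpleTr l) (toRat f)) (ratPerm (simpleTr l * simpleTr k) (toRat f))
    (ratPerm (simpleTr k * (simpleTr l * simpleTr k)) (toRat f))
  simp only [LinearMap.sub_apply, Module.End.mul_apply, map_sub, toRat_crossOp, map_crossFormula,
    ratPerm_ratX, Seq.swap_vertex, ratPerm_ratPerm, simpleTr_lpos, simpleTr_rpos, hl, hlr, hrl,
    simpleTr_lpos_of_succ h, simpleTr_rpos_of_succ h, simpleTr_mul_self, ratPerm_one, mul_assoc,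
    ← simpleTr_braid h]
  refine key.trans ?_
  split_ifs <;> simp only [Module.End.one_apply, LinearMap.zero_apply, map_zero]

end CrossOp

section MatrixOp

variable {ι M : Type*} [AddCommGroup M] {i j : ι}

/-- The operator on a direct sum of copies of `M` which takes the `i`-th copy to the `j`-th copy
by `T` and the other copies to zero. -/
noncomputable def matrixOp (j i : ι) : Module.End ℤ M →ₗ[ℤ] Module.End ℤ (ι →₀ M) where
  toFun T := Finsupp.lsingle j ∘ₗ T ∘ₗ Finsupp.lapply i
  map_add' S T := by rw [LinearMap.add_comp, LinearMap.comp_add]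
  map_smul' n T := by rw [LinearMap.smul_comp, LinearMap.comp_smul, RingHom.id_apply]

theorem matrixOp_single (j i : ι) (T : Module.End ℤ M) (f : M) :
    matrixOp j i T (Finsupp.single i f) = Finsupp.single j (T f) := by
  simp [matrixOp]

theorem matrixOp_single_ne {i' : ι} (j : ι) (h : i' ≠ i) (T : Module.End ℤ M) (f : M) :
    matrixOp j i T (Finsupp.single i' f) = 0 := by
  simp [matrixOp, h.symm]

theorem matrixOp_mul (k j i : ι) (S T : Module.End ℤ M) :
    matrixOp k j S * matrixOp j i T = matrixOp k i (S * T) :=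
  LinearMap.ext fun f => by simp [matrixOp]

theorem matrixOp_mul_ne {j' : ι} (k i : ι) (h : j' ≠ j) (S T : Module.End ℤ M) :
    matrixOp k j' S * matrixOp j i T = 0 :=
  LinearMap.ext fun f => by simp [matrixOp, h]

theorem sum_matrixOp [Fintype ι] : ∑ i : ι, matrixOp i i (1 : Module.End ℤ M) = 1 := by
  refine Finsupp.lhom_ext fun i f => ?_
  rw [LinearMap.sum_apply, Finset.sum_eq_single i (fun j _ h => matrixOp_single_ne j h.symm 1 f)
    fun h => absurd (Finset.mem_univ i) h, matrixOp_single]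
  rfl

end MatrixOp

section Action

variable {I : Type*} {Γ : SimpleGraph I} {ν : I →₀ ℕ} (o : Orientation Γ)

/-- The action of the elementary diagrams on `Pol_ν`. -/
noncomputable def genOp : Gen ν → Module.End ℤ (Pol ν)
  | .idem i => matrixOp i i 1
  | .dot k i => matrixOp i i (LinearMap.mulLeft ℤ (X k))
  | .cross k i => matrixOp (i.swap k) i (crossOp o k i)

theorem lift_genOp_rel {a b : FreeAlgebra ℤ (Gen ν)} (h : Rel Γ ν a b) :
    FreeAlgebra.lift ℤ (genOp o) a = FreeAlgebra.lift ℤ (genOp o) b := by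
  induction h with
    simp only [fe, fx, fd, map_mul, map_sub, map_add, map_sum, map_zero, map_one,
      FreeAlgebra.lift_ι_apply, genOp, matrixOp_mul, mul_one, one_mul]
  | idem_mul_ne i j h => exact matrixOp_mul_ne _ _ h _ _
  | sum_idem => exact sum_matrixOp
  | dot_dot k l i => exact congrArg _ (LinearMap.ext fun f => mul_left_comm (X k) (X l) f)
  | cross_dot k l i hl hr => rw [crossOp_mul_X o i hl hr]
  | cross_cross k l i h => rw [crossOp_comm o h i, Seq.swap_comm h i]
  | double_eq k i h => rw [crossOp_sq_eq o h, map_zero]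
  | double_far k i hne h => rw [crossOp_sq_far o hne h, Seq.swap_swap]
  | double_adj k i h => rw [crossOp_sq_adj o h, Seq.swap_swap, map_add]
  | slide_ne_left k i h => rw [← X_mul_crossOp_of_ne o h, simpleTr_rpos]
  | slide_ne_right k i h => rw [← X_mul_crossOp_of_ne o h, simpleTr_lpos]
  | slide_eq_left k i h => rw [Seq.swap_eq_self h, ← map_sub, X_lpos_mul_crossOp_of_eq o h]
  | slide_eq_right k i h => rw [Seq.swap_eq_self h, ← map_sub, crossOp_mul_X_lpos_of_eq o h]
  | braid_easy k l hkl i h =>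
    rw [Seq.swap_braid hkl, ← sub_eq_zero, ← map_sub, crossOp_braid o hkl, if_neg h, map_zero]
  | braid_hard k l hkl i h hadj =>
    rw [Seq.swap_braid hkl, Seq.swap_swap_swap_eq_self hkl h, ← map_sub, crossOp_braid o hkl,
      if_pos ⟨h, hadj⟩]

/-- The action of `R(ν)` on `Pol_ν`. -/
noncomputable def polAction : R Γ ν →+* Module.End ℤ (Pol ν) :=
  RingQuot.lift ⟨(FreeAlgebra.lift ℤ (genOp o)).toRingHom, fun _ _ h => lift_genOp_rel o h⟩

theorem polAction_mk_ι (g : Gen ν) : polAction o (mk Γ ν (FreeAlgebra.ι ℤ g)) = genOp o g :=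
  (RingQuot.lift_mkRingHom_apply ..).trans (FreeAlgebra.lift_ι_apply ..)

theorem polAction_e (i : Seq ν) : polAction o (e Γ i) = matrixOp i i 1 := polAction_mk_ι o _

theorem polAction_x (k : Fin (len ν)) (i : Seq ν) :
    polAction o (x Γ k i) = matrixOp i i (LinearMap.mulLeft ℤ (X k)) := polAction_mk_ι o _

theorem polAction_δ (k : Fin (len ν - 1)) (i : Seq ν) :
    polAction o (δ Γ k i) = matrixOp (i.swap k) i (crossOp o k i) := polAction_mk_ι o _

theorem isPolAction_polAction : IsPolAction o (polAction (ν := ν) o) where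
  idem_self i f := by rw [polAction_e, matrixOp_single]; rfl
  idem_ne i j f h := by rw [polAction_e, matrixOp_single_ne _ h]
  dot k i f := by rw [polAction_x, matrixOp_single]; rfl
  cross_far k i f h hadj := by
    rw [polAction_δ, matrixOp_single,
      crossOp_of_not_arrow o h fun harrow => hadj ((o.adj_iff _ _).2 (.inl harrow))]
  cross_eq k i f h :=
    ⟨crossOp o k i f, mul_crossOp_of_eq o h f, by rw [polAction_δ, matrixOp_single]⟩
  cross_left k i f h := by
    rw [polAction_δ, matrixOp_single, crossOp_of_not_arrow o _ (o.asymm _ _ h)]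
    exact fun heq => o.not_arrow_self _ (heq ▸ h)
  cross_right k i f h := by rw [polAction_δ, matrixOp_single, crossOp_of_arrow o h]

variable {o} {ρ : R Γ ν →+* Module.End ℤ (Pol ν)}

theorem IsPolAction.apply_δ_single (hρ : IsPolAction o ρ) (k : Fin (len ν - 1)) (i : Seq ν)
    (f : MvPolynomial (Fin (len ν)) ℤ) :
    ρ (δ Γ k i) (Finsupp.single i f) = Finsupp.single (i.swap k) (crossOp o k i f) := by
  by_cases heq : i.vertex (lpos k) = i.vertex (rpos k)
  · obtain ⟨g, hg, hg'⟩ := hρ.cross_eq k i f heq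
    rw [← mul_crossOp_of_eq o heq f] at hg
    rw [hg', mulLeft_X_sub_X_injective (lpos_ne_rpos k) hg]
  by_cases hlr : o.arrow (i.vertex (lpos k)) (i.vertex (rpos k))
  · rw [hρ.cross_right k i f hlr, crossOp_of_arrow o hlr]
  rw [crossOp_of_not_arrow o heq hlr]
  by_cases hrl : o.arrow (i.vertex (rpos k)) (i.vertex (lpos k))
  · exact hρ.cross_left k i f hrl
  · exact hρ.cross_far k i f heq fun hadj => ((o.adj_iff _ _).1 hadj).elim hlr hrl

theorem IsPolAction.eq_matrixOp (hρ : IsPolAction o ρ) {r : R Γ ν} {i j : Seq ν}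
    (hr : r * e Γ i = r) {T : Module.End ℤ (MvPolynomial (Fin (len ν)) ℤ)}
    (h : ∀ f, ρ r (Finsupp.single i f) = Finsupp.single j (T f)) : ρ r = matrixOp j i T := by
  refine Finsupp.lhom_ext fun i' f => ?_
  by_cases hi : i' = i
  · subst hi
    rw [h, matrixOp_single]
  · rw [← hr, map_mul, Module.End.mul_apply, hρ.idem_ne _ _ _ hi, map_zero,
      matrixOp_single_ne _ hi]

theorem IsPolAction.eq_polAction (hρ : IsPolAction o ρ) : ρ = polAction o := by
  refine RingHom.ext fun r => ?_
  induction r using R.induction with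
  | int n => rw [map_intCast, map_intCast]
  | he i => rw [polAction_e]; exact hρ.eq_matrixOp (e_mul_self i) (hρ.idem_self i)
  | hx k i => rw [polAction_x]; exact hρ.eq_matrixOp (x_mul_e k i) (hρ.dot k i)
  | hδ k i => rw [polAction_δ]; exact hρ.eq_matrixOp (δ_mul_e k i) (hρ.apply_δ_single k i)
  | add r s hr hs => rw [map_add, map_add, hr, hs]
  | mul r s hr hs => rw [map_mul, map_mul, hr, hs]

end Action

/-! ### Independence -/

section Triangular

variable {ι α K V : Type*} [LinearOrder α] [Field K] [AddCommGroup V] [Module K V]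

theorem eq_empty_of_sum_eq_zero_of_triangular {v : ι → V} (hv : LinearIndependent K v)
    (ℓ : ι → α) {y : ι → V} {a : ι → K} {s : Finset ι} (ha : ∀ i ∈ s, a i ≠ 0)
    (hy : ∀ i ∈ s, y i - a i • v i ∈ Submodule.span K (v '' {j | ℓ j < ℓ i}))
    (hsum : ∑ i ∈ s, y i = 0) : s = ∅ := by
  classical
  by_contra hs
  obtain ⟨i, hi, hmax⟩ := s.exists_max_image ℓ (Finset.nonempty_iff_ne_empty.2 hs)
  have lower {j : ι} (hj : j ∈ s) : y j - a j • v j ∈ Submodule.span K (v '' {i}ᶜ) :=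
    Submodule.span_mono
      (Set.image_mono fun k (hk : ℓ k < ℓ j) h => (hk.trans_le (hmax j hj)).ne (congrArg ℓ h))
      (hy j hj)
  have others : ∑ j ∈ s.erase i, y j ∈ Submodule.span K (v '' {i}ᶜ) := by
    refine sum_mem fun j hj => ?_
    obtain ⟨hji, hjs⟩ := Finset.mem_erase.1 hj
    rw [← sub_add_cancel (y j)]
    exact add_mem (lower hjs) (Submodule.smul_mem _ _ (Submodule.subset_span ⟨j, hji, rfl⟩))
  have leading : a i • v i ∈ Submodule.span K (v '' {i}ᶜ) := by
    rw [← Finset.add_sum_erase s y hi, add_eq_zero_iff_eq_neg] at hsum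
    have := sub_mem (neg_mem others) (lower hi)
    rwa [← hsum, sub_sub_cancel] at this
  rw [Submodule.smul_mem_iff _ (ha i hi)] at leading
  exact hv.notMem_span_image (by simp) leading

end Triangular

section PermFun

variable {σ : Type*}

/-- The permutation `w` of the variables, as a function from polynomials to rational functions. -/
noncomputable def permFun (w : Equiv.Perm σ) (f : MvPolynomial σ ℤ) : RatField σ :=
  ratPerm w (toRat f)

theorem ratPerm_comp_permFun (v w : Equiv.Perm σ) :
    ratPerm v ∘ permFun w = permFun (v * w) :=
  funext fun f => ratPerm_ratPerm v w (toRat f)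

theorem permFun_comp_mul (w : Equiv.Perm σ) (c : MvPolynomial σ ℤ) :
    permFun w ∘ (c * ·) = ratPerm w (toRat c) • permFun w :=
  funext fun f => by simp [permFun]

theorem linearIndependent_permFun : LinearIndependent (RatField σ) (permFun (σ := σ)) := by
  let toMonoidHom (w : Equiv.Perm σ) : MvPolynomial σ ℤ →* RatField σ := (ratPerm w).comp toRat
  have hinj : Function.Injective toMonoidHom := fun v w h => Equiv.ext fun a => ratX_injective <| by
    rw [← ratPerm_ratX, ← ratPerm_ratX]
    exact DFunLike.congr_fun h (X a)
  exact (linearIndependent_monoidHom (MvPolynomial σ ℤ) (RatField σ)).comp toMonoidHom hinj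

end PermFun

section ShortSpan

variable {m n : ℕ}

/-- The combinations of the permutations of the variables which are products of fewer than `n`
simple transpositions. -/
noncomputable def shortSpan (m n : ℕ) :
    Submodule (RatField (Fin m)) (MvPolynomial (Fin m) ℤ → RatField (Fin m)) :=
  Submodule.span _ (permFun '' {w | ∃ l : List (Fin (m - 1)), l.length < n ∧ wordProd l = w})

theorem shortSpan_mono (m : ℕ) : Monotone (shortSpan m) := fun _ _ h =>
  Submodule.span_mono (Set.image_mono fun _ ⟨l, hl, hw⟩ => ⟨l, hl.trans_le h, hw⟩)

theorem permFun_mem_shortSpan {l : List (Fin (m - 1))} (h : l.length < n) :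
    permFun (wordProd l) ∈ shortSpan m n :=
  Submodule.subset_span ⟨_, ⟨l, h, rfl⟩, rfl⟩

theorem ratPerm_comp_mem_shortSpan (k : Fin (m - 1))
    {g : MvPolynomial (Fin m) ℤ → RatField (Fin m)} (hg : g ∈ shortSpan m n) :
    ratPerm (simpleTr k) ∘ g ∈ shortSpan m (n + 1) := by
  induction hg using Submodule.span_induction with
  | mem g hg =>
    obtain ⟨_, ⟨l, hl, rfl⟩, rfl⟩ := hg
    rw [ratPerm_comp_permFun, ← wordProd_cons]
    exact permFun_mem_shortSpan (Nat.succ_lt_succ hl)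
  | zero => convert zero_mem (shortSpan m (n + 1)); exact funext fun _ => map_zero _
  | add g h _ _ hg hh => convert add_mem hg hh; exact funext fun _ => map_add ..
  | smul c g _ hg =>
    convert Submodule.smul_mem _ (ratPerm (simpleTr k) c) hg
    exact funext fun _ => map_mul ..

theorem comp_mul_mem_shortSpan (c : MvPolynomial (Fin m) ℤ)
    {g : MvPolynomial (Fin m) ℤ → RatField (Fin m)} (hg : g ∈ shortSpan m n) :
    g ∘ (c * ·) ∈ shortSpan m n := by
  induction hg using Submodule.span_induction with
  | mem g hg =>
    obtain ⟨_, ⟨l, hl, rfl⟩, rfl⟩ := hg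
    rw [permFun_comp_mul]
    exact Submodule.smul_mem _ _ (permFun_mem_shortSpan hl)
  | zero => exact zero_mem _
  | add g h _ _ hg hh => exact add_mem hg hh
  | smul b g _ hg => exact Submodule.smul_mem _ b hg

theorem shortSpan_le {word : Equiv.Perm (Fin m) → List (Fin (m - 1))}
    (hword : ∀ w, IsMinimalPresentation (word w) w) (n : ℕ) :
    shortSpan m n ≤ Submodule.span _ (permFun '' {w | (word w).length < n}) :=
  Submodule.span_mono <| Set.image_mono fun w ⟨l, hl, hw⟩ => ((hword w).2 l hw).trans_lt hl

end ShortSpan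

section Words

variable {I : Type*} {Γ : SimpleGraph I} {ν : I →₀ ℕ} (o : Orientation Γ)

theorem exists_toRat_crossOp (k : Fin (len ν - 1)) (i : Seq ν) :
    ∃ a b : RatField (Fin (len ν)), a ≠ 0 ∧ ∀ f, toRat (crossOp o k i f) =
      a * ratPerm (simpleTr k) (toRat f) + b * toRat f := by
  simp only [toRat_crossOp]
  by_cases h : i.vertex (lpos k) = i.vertex (rpos k)
  · have hne := inv_ne_zero (ratX_sub_ne_zero (lpos_ne_rpos k))
    refine ⟨-(ratX (lpos k) - ratX (rpos k))⁻¹, (ratX (lpos k) - ratX (rpos k))⁻¹,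
      neg_ne_zero.2 hne, fun f => ?_⟩
    rw [h, crossFormula_self]
    ring
  · refine ⟨edgeFactor o (i.vertex (lpos k)) (i.vertex (rpos k)) (ratX (lpos k)) (ratX (rpos k)), 0,
      edgeFactor_ne_zero o (ratX_add_ne_zero _ _), fun f => ?_⟩
    rw [crossFormula_of_ne o h, zero_mul, add_zero]

/-- The action on polynomials of the diagram given by a word. -/
noncomputable def wordOp (i : Seq ν) :
    List (Fin (len ν - 1)) → Module.End ℤ (MvPolynomial (Fin (len ν)) ℤ)
  | [] => 1
  | k :: l => crossOp o k (i.act l) * wordOp i l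

theorem polAction_hat (l : List (Fin (len ν - 1))) (i : Seq ν) :
    polAction o (hat Γ l i) = matrixOp (i.act l) i (wordOp o i l) := by
  induction l with
  | nil => exact polAction_e o i
  | cons k l ih => rw [hat_cons, map_mul, ih, polAction_δ, matrixOp_mul]; rfl

theorem polAction_dotEval_single (i : Seq ν) (p f : MvPolynomial (Fin (len ν)) ℤ) :
    polAction o (dotEval Γ i p) (Finsupp.single i f) = Finsupp.single i (p * f) := by
  induction p using MvPolynomial.induction_on generalizing f with
  | C a => simp [← MvPolynomial.C_mul']
  | add p q hp hq => rw [map_add, map_add, LinearMap.add_apply, hp, hq, add_mul, Finsupp.single_add]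
  | mul_X p k hp =>
    rw [map_mul, map_mul, Module.End.mul_apply, dotEval_X, polAction_x, matrixOp_single, hp,
      LinearMap.mulLeft_apply, mul_assoc]

theorem exists_wordOp_sub_mem_shortSpan (i : Seq ν) (l : List (Fin (len ν - 1))) :
    ∃ a : RatField (Fin (len ν)), a ≠ 0 ∧
      toRat ∘ wordOp o i l - a • permFun (wordProd l) ∈ shortSpan (len ν) l.length := by
  induction l with
  | nil =>
    refine ⟨1, one_ne_zero, ?_⟩
    have : toRat ∘ wordOp o i [] = permFun (wordProd []) :=
      funext fun f => (ratPerm_one (toRat f)).symm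
    rw [this, one_smul, sub_self]
    exact zero_mem _
  | cons k l ih =>
    obtain ⟨a, ha, hlow⟩ := ih
    obtain ⟨b, c, hb, hcross⟩ := exists_toRat_crossOp o k (i.act l)
    refine ⟨b * ratPerm (simpleTr k) a, mul_ne_zero hb ((map_ne_zero _).2 ha), ?_⟩
    set g := toRat ∘ wordOp o i l - a • permFun (wordProd l) with hg
    have key : toRat ∘ wordOp o i (k :: l) -
        (b * ratPerm (simpleTr k) a) • permFun (wordProd (k :: l)) =
        b • (ratPerm (simpleTr k) ∘ g) + ((c * a) • permFun (wordProd l) + c • g) := by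
      ext1 f
      simp only [hg, wordOp, Module.End.mul_apply, hcross, Pi.add_apply, Pi.sub_apply,
        Pi.smul_apply, smul_eq_mul, wordProd_cons, ← ratPerm_comp_permFun, Function.comp_apply,
        map_sub, map_mul]
      ring
    rw [key, List.length_cons]
    exact add_mem (Submodule.smul_mem _ _ (ratPerm_comp_mem_shortSpan k hlow))
      (add_mem (Submodule.smul_mem _ _ (permFun_mem_shortSpan l.length.lt_succ_self))
        (Submodule.smul_mem _ _ (shortSpan_mono _ l.length.le_succ hlow)))

variable {word : Equiv.Perm (Fin (len ν)) → List (Fin (len ν - 1))}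

theorem eq_zero_of_sum_wordOp (hword : ∀ w, IsMinimalPresentation (word w) w) (i : Seq ν)
    {c : Equiv.Perm (Fin (len ν)) →₀ MvPolynomial (Fin (len ν)) ℤ}
    (h : ∀ f, c.sum (fun w p => wordOp o i (word w) (p * f)) = 0) : c = 0 := by
  choose a ha hlow using fun w => exists_wordOp_sub_mem_shortSpan o i (word w)
  refine Finsupp.support_eq_empty.1 <| eq_empty_of_sum_eq_zero_of_triangular
    linearIndependent_permFun (fun w => (word w).length)
    (y := fun w => toRat ∘ wordOp o i (word w) ∘ (c w * ·))
    (a := fun w => a w * ratPerm w (toRat (c w))) (fun w hw => ?_) (fun w _ => ?_) ?_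
  · have hc : toRat (c w) ≠ 0 :=
      (map_ne_zero_iff _ toRat_injective).2 (Finsupp.mem_support_iff.1 hw)
    exact mul_ne_zero (ha w) ((map_ne_zero _).2 hc)
  · refine shortSpan_le hword _ ?_
    convert comp_mul_mem_shortSpan (c w) (hlow w) using 1
    ext1 f
    simp only [Pi.sub_apply, Pi.smul_apply, smul_eq_mul, Function.comp_apply, permFun,
      (hword w).1, map_mul, mul_assoc]
  · ext1 f
    simp only [Finset.sum_apply, Function.comp_apply, ← map_sum]
    exact (congrArg toRat (h f)).trans (map_zero _)

end Words

section HatSum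

variable {I : Type*} {Γ : SimpleGraph I} {ν : I →₀ ℕ}
  {word : Equiv.Perm (Fin (len ν)) → List (Fin (len ν - 1))}

variable (Γ word) in
/-- The sum of the elements `ŵ_i p_w` of `R(ν)` attached to a family of polynomials `p_w` in the
dots on the sequence `i`. -/
noncomputable def hatSum (i : Seq ν) :
    (Equiv.Perm (Fin (len ν)) →₀ MvPolynomial (Fin (len ν)) ℤ) →ₗ[ℤ] R Γ ν :=
  Finsupp.lsum ℤ fun w => LinearMap.mulLeft ℤ (hat Γ (word w) i) ∘ₗ (dotEval Γ i).toLinearMap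

theorem hatSum_apply (i : Seq ν) (c : Equiv.Perm (Fin (len ν)) →₀ MvPolynomial (Fin (len ν)) ℤ) :
    hatSum Γ word i c = c.sum fun w p => hat Γ (word w) i * dotEval Γ i p := rfl

theorem hatSum_single (i : Seq ν) (w : Equiv.Perm (Fin (len ν)))
    (p : MvPolynomial (Fin (len ν)) ℤ) :
    hatSum Γ word i (Finsupp.single w p) = hat Γ (word w) i * dotEval Γ i p :=
  Finsupp.lsum_single ..

theorem wordSpan_eq_range (i : Seq ν) :
    wordSpan Γ word i = LinearMap.range (hatSum Γ word i) := by
  refine le_antisymm (Submodule.span_le.2 ?_) ?_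
  · rintro _ ⟨w, p, rfl⟩
    exact ⟨_, hatSum_single i w p⟩
  · rintro _ ⟨c, rfl⟩
    exact sum_mem fun w _ => Submodule.subset_span ⟨w, c w, rfl⟩

theorem eq_zero_of_polAction_hatSum (o : Orientation Γ)
    (hword : ∀ w, IsMinimalPresentation (word w) w) (i : Seq ν)
    {c : Equiv.Perm (Fin (len ν)) →₀ MvPolynomial (Fin (len ν)) ℤ}
    (h : polAction o (hatSum Γ word i c) = 0) : c = 0 := by
  refine eq_zero_of_sum_wordOp o hword i fun f => ?_
  have := congrArg (Finsupp.lsum ℤ fun _ : Seq ν =>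
    (LinearMap.id : Module.End ℤ (MvPolynomial (Fin (len ν)) ℤ)))
    (LinearMap.congr_fun h (Finsupp.single i f))
  simpa only [hatSum_apply, Finsupp.sum, map_sum, map_mul, LinearMap.sum_apply,
    Module.End.mul_apply, polAction_dotEval_single, polAction_hat, matrixOp_single,
    LinearMap.zero_apply, map_zero, Finsupp.lsum_single, LinearMap.id_apply] using this

end HatSum

/-! ### The grading -/

section Independence

variable {ι S M N : Type*} [Ring S] [AddCommGroup M] [Module S M] [AddCommGroup N] [Module S N]

theorem iSupIndep_of_le_ker {p : ι → Submodule S M} (π : ι → M →ₗ[S] N)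
    (hker : ∀ d d', d' ≠ d → p d' ≤ LinearMap.ker (π d))
    (hdisj : ∀ d, Disjoint (p d) (LinearMap.ker (π d))) : iSupIndep p := fun d =>
  (hdisj d).mono_right (iSup₂_le (hker d))

end Independence

section CrossingDegree

variable {I : Type*} (Γ : SimpleGraph I) {ν : I →₀ ℕ}

theorem cartan_comm (p q : I) : cartan Γ p q = cartan Γ q p := by
  rw [cartan, cartan, Γ.adj_comm p q, eq_comm (a := p)]

theorem cartan_self (p : I) : cartan Γ p p = 2 := if_pos rfl

/-- The degree of the crossing `δ_{k,i}`. -/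
noncomputable def crossDeg (k : Fin (len ν - 1)) (i : Seq ν) : ℤ :=
  -cartan Γ (i.vertex (lpos k)) (i.vertex (rpos k))

theorem crossDeg_swap (k : Fin (len ν - 1)) (i : Seq ν) :
    crossDeg Γ k (i.swap k) = crossDeg Γ k i := by
  simp only [crossDeg, Seq.swap_vertex, simpleTr_lpos, simpleTr_rpos, cartan_comm]

variable {k l : Fin (len ν - 1)}

theorem crossDeg_swap_of_far (h : k.val + 1 < l.val ∨ l.val + 1 < k.val) (i : Seq ν) :
    crossDeg Γ l (i.swap k) = crossDeg Γ l i := by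
  simp only [crossDeg, Seq.swap_vertex, simpleTr_lpos_of_far h, simpleTr_rpos_of_far h]

theorem crossDeg_swap_of_succ (h : l.val = k.val + 1) (i : Seq ν) :
    crossDeg Γ l (i.swap k) = -cartan Γ (i.vertex (lpos k)) (i.vertex (rpos l)) := by
  simp only [crossDeg, Seq.swap_vertex, lpos_eq_rpos_of_succ h, simpleTr_rpos,
    simpleTr_rpos_of_succ h]

theorem crossDeg_swap_of_pred (h : l.val = k.val + 1) (i : Seq ν) :
    crossDeg Γ k (i.swap l) = -cartan Γ (i.vertex (lpos k)) (i.vertex (rpos l)) := by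
  simp only [crossDeg, Seq.swap_vertex, ← lpos_eq_rpos_of_succ h, simpleTr_lpos,
    simpleTr_lpos_of_succ h]

theorem crossDeg_swap_swap_of_succ (h : l.val = k.val + 1) (i : Seq ν) :
    crossDeg Γ k ((i.swap k).swap l) = crossDeg Γ l i := by
  simp only [crossDeg, Seq.swap_vertex, ← lpos_eq_rpos_of_succ h, simpleTr_lpos,
    simpleTr_lpos_of_succ h, simpleTr_rpos_of_succ h]

theorem crossDeg_swap_swap_of_pred (h : l.val = k.val + 1) (i : Seq ν) :
    crossDeg Γ l ((i.swap l).swap k) = crossDeg Γ k i := by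
  simp only [crossDeg, Seq.swap_vertex, lpos_eq_rpos_of_succ h, simpleTr_rpos,
    simpleTr_rpos_of_succ h, simpleTr_lpos_of_succ h]

variable {Γ} {i : Seq ν}

theorem crossDeg_of_eq (h : i.vertex (lpos k) = i.vertex (rpos k)) : crossDeg Γ k i = -2 := by
  simp [crossDeg, cartan, h]

theorem crossDeg_of_adj (h : Γ.Adj (i.vertex (lpos k)) (i.vertex (rpos k))) :
    crossDeg Γ k i = 1 := by
  simp [crossDeg, cartan, h, h.ne]

theorem crossDeg_of_not_adj (hne : i.vertex (lpos k) ≠ i.vertex (rpos k))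
    (h : ¬ Γ.Adj (i.vertex (lpos k)) (i.vertex (rpos k))) : crossDeg Γ k i = 0 := by
  simp [crossDeg, cartan, h, hne]

end CrossingDegree

section Coaction

variable {I : Type*} (Γ : SimpleGraph I) {ν : I →₀ ℕ}

/-- The elementary diagrams, with a formal variable recording their degrees. -/
noncomputable def degGen : Gen ν → AddMonoidAlgebra (R Γ ν) ℤ
  | .idem i => .single 0 (e Γ i)
  | .dot k i => .single 2 (x Γ k i)
  | .cross k i => .single (crossDeg Γ k i) (δ Γ k i)

theorem lift_degGen_rel {a b : FreeAlgebra ℤ (Gen ν)} (h : Rel Γ ν a b) :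
    FreeAlgebra.lift ℤ (degGen Γ) a = FreeAlgebra.lift ℤ (degGen Γ) b := by
  have hrel := mk_rel h
  induction h with simp only [fe, fx, fd, degGen, map_mul, map_sub, map_add, map_sum, map_one,
    map_zero, FreeAlgebra.lift_ι_apply, AddMonoidAlgebra.single_mul_single] at hrel ⊢
  | idem_mul_self | dot_bot | cross_bot =>
    exact congrArg₂ AddMonoidAlgebra.single (add_zero _) hrel
  | dot_top | cross_top => exact congrArg₂ AddMonoidAlgebra.single (zero_add _) hrel
  | dot_dot => exact congrArg (AddMonoidAlgebra.single _) hrel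
  | cross_dot | slide_ne_left | slide_ne_right =>
    exact congrArg₂ AddMonoidAlgebra.single (add_comm _ _) hrel
  | idem_mul_ne | double_eq =>
    exact (congrArg (AddMonoidAlgebra.single _) hrel).trans (AddMonoidAlgebra.single_zero _)
  | sum_idem =>
    rw [AddMonoidAlgebra.one_def, ← sum_e]
    exact (map_sum (AddMonoidAlgebra.singleAddHom (0 : ℤ)) _ _).symm
  | cross_cross k l i h =>
    rw [crossDeg_swap_of_far Γ (.inl h), crossDeg_swap_of_far Γ (.inr h)]
    exact congrArg₂ AddMonoidAlgebra.single (add_comm _ _) hrel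
  | double_far k i hne h =>
    rw [crossDeg_swap, crossDeg_of_not_adj hne h]
    exact congrArg (AddMonoidAlgebra.single _) hrel
  | double_adj k i h =>
    rw [crossDeg_swap, crossDeg_of_adj h, ← AddMonoidAlgebra.single_add]
    exact congrArg (AddMonoidAlgebra.single _) hrel
  | slide_eq_left _ _ h | slide_eq_right _ _ h =>
    rw [crossDeg_of_eq h, add_comm (2 : ℤ), ← AddMonoidAlgebra.single_sub]
    exact congrArg (AddMonoidAlgebra.single _) hrel
  | braid_easy k l hkl i h =>
    rw [crossDeg_swap_swap_of_succ Γ hkl, crossDeg_swap_swap_of_pred Γ hkl,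
      crossDeg_swap_of_succ Γ hkl, crossDeg_swap_of_pred Γ hkl]
    exact congrArg₂ AddMonoidAlgebra.single (by ring) hrel
  | braid_hard k l hkl i h hadj =>
    have hadj' : Γ.Adj (i.vertex (lpos l)) (i.vertex (rpos l)) := by
      rw [lpos_eq_rpos_of_succ hkl, ← h]; exact hadj.symm
    rw [crossDeg_swap_swap_of_succ Γ hkl, crossDeg_swap_swap_of_pred Γ hkl,
      crossDeg_swap_of_succ Γ hkl, crossDeg_swap_of_pred Γ hkl, crossDeg_of_adj hadj,
      crossDeg_of_adj hadj', h, cartan_self, ← AddMonoidAlgebra.single_sub]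
    exact congrArg (AddMonoidAlgebra.single _) hrel

/-- The coaction `r ↦ r T ^ d`, for `r` homogeneous of degree `d`, which defines the grading of
`R(ν)`. -/
noncomputable def coaction (ν : I →₀ ℕ) : R Γ ν →+* AddMonoidAlgebra (R Γ ν) ℤ :=
  RingQuot.lift ⟨(FreeAlgebra.lift ℤ (degGen Γ)).toRingHom, fun _ _ h => lift_degGen_rel Γ h⟩

theorem coaction_mk_ι (g : Gen ν) : coaction Γ ν (mk Γ ν (FreeAlgebra.ι ℤ g)) = degGen Γ g :=
  (RingQuot.lift_mkRingHom_apply ..).trans (FreeAlgebra.lift_ι_apply ..)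

theorem coaction_eval {i j : Seq ν} (D : Diagram i j) :
    coaction Γ ν (D.eval Γ) = .single (D.degree Γ) (D.eval Γ) := by
  induction D with
  | id => exact coaction_mk_ι Γ _
  | dot k D ih =>
    rw [Diagram.eval, map_mul, ih, x, fx, coaction_mk_ι]
    exact AddMonoidAlgebra.single_mul_single ..
  | cross k D ih =>
    rw [Diagram.eval, map_mul, ih, δ, fd, coaction_mk_ι]
    exact AddMonoidAlgebra.single_mul_single ..

variable {Γ}

theorem coaction_of_mem {d : ℤ} {r : R Γ ν} (hr : r ∈ degPart Γ ν d) :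
    coaction Γ ν r = .single d r := by
  refine LinearMap.eqOn_span (f := (coaction Γ ν).toAddMonoidHom.toIntLinearMap)
    (g := (AddMonoidAlgebra.singleAddHom d).toIntLinearMap) ?_ hr
  rintro _ ⟨i, j, D, rfl, rfl⟩
  exact coaction_eval Γ D

variable (Γ) in
/-- The component of degree `d` of an element of `R(ν)`, read off from the coaction. -/
noncomputable def degProj (ν : I →₀ ℕ) (d : ℤ) : R Γ ν →ₗ[ℤ] R Γ ν :=
  ((Finsupp.applyAddHom d).comp (AddMonoidAlgebra.coeffAddEquiv.toAddMonoidHom.comp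
    (coaction Γ ν).toAddMonoidHom)).toIntLinearMap

theorem degProj_of_mem {d : ℤ} {r : R Γ ν} (hr : r ∈ degPart Γ ν d) (d' : ℤ) :
    degProj Γ ν d' r = if d = d' then r else 0 :=
  (congrArg (fun s => AddMonoidAlgebra.coeff s d') (coaction_of_mem hr)).trans
    Finsupp.single_apply

theorem iSupIndep_homDegPart (j i : Seq ν) : iSupIndep (homDegPart Γ j i) :=
  iSupIndep_of_le_ker (fun d => degProj Γ ν d ∘ₗ (homPart Γ j i).subtype)
    (fun d _ hd _ hr => (degProj_of_mem hr d).trans (if_neg hd))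
    fun d => Submodule.disjoint_def.2 fun _ hr h0 =>
      Subtype.ext (((degProj_of_mem hr d).trans (if_pos rfl)).symm.trans h0)

end Coaction

section Multiplication

variable {I : Type*} {Γ : SimpleGraph I} {ν : I →₀ ℕ} {i j k : Seq ν}

/-- The diagram obtained by putting the first diagram on top of the second one. -/
def Diagram.comp {i j : Seq ν} : {k : Seq ν} → Diagram j k → Diagram i j → Diagram i k
  | _, .id, E => E
  | _, .dot a D, E => .dot a (D.comp E)
  | _, .cross a D, E => .cross a (D.comp E)

theorem e_mul_eval (D : Diagram i j) : e Γ j * D.eval Γ = D.eval Γ := by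
  cases D with
  | id => exact e_mul_self i
  | dot k D => rw [Diagram.eval, ← mul_assoc, e_mul_x]
  | cross k D => rw [Diagram.eval, ← mul_assoc, e_mul_δ]

theorem eval_mul_e (D : Diagram i j) : D.eval Γ * e Γ i = D.eval Γ := by
  induction D with
  | id => exact e_mul_self i
  | dot k D ih | cross k D ih => rw [Diagram.eval, mul_assoc, ih]

theorem Diagram.eval_comp (D : Diagram j k) (E : Diagram i j) :
    (D.comp E).eval Γ = D.eval Γ * E.eval Γ := by
  induction D with
  | id => exact (e_mul_eval E).symm
  | dot a D ih | cross a D ih => rw [comp, eval, eval, ih, mul_assoc]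

theorem Diagram.degree_comp (D : Diagram j k) (E : Diagram i j) :
    (D.comp E).degree Γ = D.degree Γ + E.degree Γ := by
  induction D with
  | id => exact (zero_add _).symm
  | dot a D ih | cross a D ih => rw [comp, degree, degree, ih, add_assoc]

theorem eval_mul_eval_of_ne {i' j' : Seq ν} (h : i ≠ j') (D : Diagram i j) (E : Diagram i' j') :
    D.eval Γ * E.eval Γ = 0 := by
  rw [← eval_mul_e D, ← e_mul_eval E, mul_assoc, ← mul_assoc (e Γ i), e_mul_ne h, zero_mul,
    mul_zero]

theorem eval_mem_degPart (D : Diagram i j) : D.eval Γ ∈ degPart Γ ν (D.degree Γ) :=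
  Submodule.subset_span ⟨i, j, D, rfl, rfl⟩

instance degPart.gradedMonoid : SetLike.GradedMonoid (degPart Γ ν) where
  one_mem := sum_e (Γ := Γ) ▸ sum_mem fun i _ => eval_mem_degPart (.id (i := i))
  mul_mem c d a b ha hb := by
    suffices degPart Γ ν c * degPart Γ ν d ≤ degPart Γ ν (c + d) from
      this (Submodule.mul_mem_mul ha hb)
    rw [degPart, degPart, Submodule.span_mul_span, Submodule.span_le]
    rintro _ ⟨_, ⟨i, j, D, rfl, rfl⟩, _, ⟨i', j', E, rfl, rfl⟩, rfl⟩
    obtain rfl | h := eq_or_ne i j'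
    · simp only [SetLike.mem_coe, ← Diagram.degree_comp, ← Diagram.eval_comp]
      exact eval_mem_degPart (D.comp E)
    · simp only [eval_mul_eval_of_ne h, SetLike.mem_coe, zero_mem]

theorem x_mem_degPart (a : Fin (len ν)) (i : Seq ν) : x Γ a i ∈ degPart Γ ν 2 :=
  x_mul_e (Γ := Γ) a i ▸ eval_mem_degPart (.dot a (.id (i := i)))

theorem dotMonomial_mem_degPart (i : Seq ν) (u : Fin (len ν) → ℕ) :
    dotMonomial Γ i u ∈ degPart Γ ν (2 * ∑ a, (u a : ℤ)) := by
  have := SetLike.list_prod_ofFn_mem_graded (A := degPart Γ ν) _ _ fun a =>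
    SetLike.pow_mem_graded (u a) (x_mem_degPart a i)
  simpa only [dotMonomial, List.sum_ofFn, nsmul_eq_mul, ← Finset.sum_mul, mul_comm] using this

theorem hat_mul_dotMonomial_mem_degPart (l : List (Fin (len ν - 1))) (i : Seq ν)
    (u : Fin (len ν) → ℕ) : hat Γ l i * dotMonomial Γ i u ∈
      degPart Γ ν ((wordDiagram i l).degree Γ + 2 * ∑ a, (u a : ℤ)) :=
  SetLike.mul_mem_graded (eval_mem_degPart (wordDiagram i l)) (dotMonomial_mem_degPart i u)

end Multiplication

/-! ### The basis -/

section Basis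

variable {I : Type*} {Γ : SimpleGraph I} {ν : I →₀ ℕ}
  {word : Equiv.Perm (Fin (len ν)) → List (Fin (len ν - 1))}

theorem exists_orientation (Γ : SimpleGraph I) : Nonempty (Orientation Γ) := by
  classical
  let : LinearOrder I := linearOrderOfSTO WellOrderingRel
  exact ⟨{
    arrow := fun i j => Γ.Adj i j ∧ i < j
    adj_iff := fun i j => ⟨fun h => (lt_or_gt_of_ne h.ne).imp (⟨h, ·⟩) (⟨h.symm, ·⟩),
      fun h => h.elim And.left fun h => h.1.symm⟩
    asymm := fun i j h h' => lt_asymm h.2 h'.2 }⟩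

theorem hatSum_injective (hword : ∀ w, IsMinimalPresentation (word w) w) (i : Seq ν) :
    Function.Injective (hatSum Γ word i) := by
  obtain ⟨o⟩ := exists_orientation Γ
  exact (injective_iff_map_eq_zero _).2 fun c hc =>
    eq_zero_of_polAction_hatSum o hword i (by rw [hc, map_zero])

theorem polAction_injective (hword : ∀ w, IsMinimalPresentation (word w) w) (o : Orientation Γ) :
    Function.Injective (polAction (ν := ν) o) := by
  refine (injective_iff_map_eq_zero _).2 fun r hr => ?_
  have mul_e_eq_zero (i : Seq ν) : r * e Γ i = 0 := by
    obtain ⟨c, hc⟩ := wordSpan_eq_range i ▸ mul_e_mem_wordSpan hword i r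
    have hc0 : polAction o (hatSum Γ word i c) = 0 := by rw [hc, map_mul, hr, zero_mul]
    rw [← hc, eq_zero_of_polAction_hatSum o hword i hc0, map_zero]
  rw [← mul_one r, ← sum_e, Finset.mul_sum]
  exact Finset.sum_eq_zero fun i _ => mul_e_eq_zero i

theorem hat_mul_dotEval_mem_homPart {l : List (Fin (len ν - 1))} {i j : Seq ν} (h : i.act l = j)
    (p : MvPolynomial (Fin (len ν)) ℤ) : hat Γ l i * dotEval Γ i p ∈ homPart Γ j i := by
  subst h
  refine ⟨hat Γ l i * dotEval Γ i p, ?_⟩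
  rw [← mul_assoc, e_mul_hat, mul_assoc, ← e_commute_dotEval, ← mul_assoc, hat_mul_e]

variable (Γ word) in
/-- The restriction of `hatSum` to families of polynomials indexed by `_jS_i`. -/
noncomputable def homSum (j i : Seq ν) :
    (permSet j i →₀ MvPolynomial (Fin (len ν)) ℤ) →ₗ[ℤ] R Γ ν :=
  hatSum Γ word i ∘ₗ Finsupp.lmapDomain _ ℤ Subtype.val

theorem homSum_single (j i : Seq ν) (w : permSet j i) (p : MvPolynomial (Fin (len ν)) ℤ) :
    homSum Γ word j i (Finsupp.single w p) = hat Γ (word w) i * dotEval Γ i p := by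
  rw [homSum, LinearMap.comp_apply, Finsupp.lmapDomain_apply, Finsupp.mapDomain_single,
    hatSum_single]

theorem homSum_injective (hword : ∀ w, IsMinimalPresentation (word w) w) (j i : Seq ν) :
    Function.Injective (homSum Γ word j i) :=
  (hatSum_injective hword i).comp (Finsupp.mapDomain_injective Subtype.val_injective)

theorem range_homSum (hword : ∀ w, IsMinimalPresentation (word w) w) (j i : Seq ν) :
    LinearMap.range (homSum Γ word j i) = homPart Γ j i := by
  have act_word (w) : i.act (word w) = i.perm w := by rw [Seq.act_eq_perm, (hword w).1]
  refine le_antisymm ?_ ?_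
  · rintro _ ⟨c, rfl⟩
    induction c using Finsupp.induction_linear with
    | zero => rw [map_zero]; exact zero_mem _
    | add c d hc hd => rw [map_add]; exact add_mem hc hd
    | single w p =>
      rw [homSum_single]
      exact hat_mul_dotEval_mem_homPart ((act_word w).trans w.2) p
  · suffices h : wordSpan Γ word i ≤
        (LinearMap.range (homSum Γ word j i)).comap (LinearMap.mulLeft ℤ (e Γ j)) by
      rintro _ ⟨r, rfl⟩
      rw [mul_assoc]
      exact h (mul_e_mem_wordSpan hword i r)
    refine Submodule.span_le.2 ?_
    rintro _ ⟨w, p, rfl⟩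
    rw [SetLike.mem_coe, Submodule.mem_comap, LinearMap.mulLeft_apply, ← mul_assoc, ← e_mul_hat,
      ← mul_assoc]
    obtain rfl | hj := eq_or_ne j (i.act (word w))
    · rw [e_mul_self, e_mul_hat]
      exact ⟨Finsupp.single ⟨w, (act_word w).symm⟩ p, homSum_single ..⟩
    · rw [e_mul_ne hj, zero_mul, zero_mul]
      exact zero_mem _

/-- The basis of `_jR(ν)_i` formed by the elements `ŵ_i x^u`. -/
noncomputable def hatBasis (hword : ∀ w, IsMinimalPresentation (word w) w) (j i : Seq ν) :
    Module.Basis (permSet j i × (Fin (len ν) → ℕ)) ℤ (homPart Γ j i) :=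
  ((Finsupp.basis fun _ => MvPolynomial.basisMonomials (Fin (len ν)) ℤ).map
    ((LinearEquiv.ofInjective _ (homSum_injective hword j i)).trans
      (LinearEquiv.ofEq _ _ (range_homSum hword j i)))).reindex
    ((Equiv.sigmaEquivProd _ _).trans ((Equiv.refl _).prodCongr Finsupp.equivFunOnFinite))

theorem hatBasis_apply (hword : ∀ w, IsMinimalPresentation (word w) w) (j i : Seq ν)
    (w : permSet j i) (u : Fin (len ν) → ℕ) :
    (hatBasis (Γ := Γ) hword j i (w, u) : R Γ ν) = hat Γ (word w) i * dotMonomial Γ i u := by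
  have hu := dotEval_monomial Γ i (Finsupp.equivFunOnFinite.symm u)
  rw [Finsupp.coe_equivFunOnFinite_symm] at hu
  simp [hatBasis, ← hu, homSum_single]

theorem hatBasis_mem (hword : ∀ w, IsMinimalPresentation (word w) w) (j i : Seq ν)
    (w : permSet j i) (u : Fin (len ν) → ℕ) : hatBasis (Γ := Γ) hword j i (w, u) ∈
      homDegPart Γ j i ((wordDiagram i (word w)).degree Γ + 2 * ∑ k, (u k : ℤ)) := by
  rw [homDegPart, Submodule.mem_comap, Submodule.subtype_apply, hatBasis_apply]
  exact hat_mul_dotMonomial_mem_degPart _ _ _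

theorem isInternal_homDegPart (hword : ∀ w, IsMinimalPresentation (word w) w) (j i : Seq ν) :
    DirectSum.IsInternal (homDegPart Γ j i) := by
  rw [DirectSum.isInternal_submodule_iff_iSupIndep_and_iSup_eq_top]
  refine ⟨iSupIndep_homDegPart j i, top_unique ?_⟩
  rw [← (hatBasis (Γ := Γ) hword j i).span_eq, Submodule.span_le]
  rintro _ ⟨⟨w, u⟩, rfl⟩
  exact Submodule.mem_iSup_of_mem _ (hatBasis_mem hword j i w u)

end Basis

end KL

theorem theorem2p5 {I : Type*} (Γ : SimpleGraph I) (ν : I →₀ ℕ)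
    (word : Equiv.Perm (Fin (KL.len ν)) → List (Fin (KL.len ν - 1)))
    (hword : ∀ w, KL.IsMinimalPresentation (word w) w) :
    (∀ i j : KL.Seq ν,
      DirectSum.IsInternal (KL.homDegPart Γ j i) ∧
      ∃ b : Module.Basis (KL.permSet j i × (Fin (KL.len ν) → ℕ)) ℤ (KL.homPart Γ j i),
        ∀ (w : KL.permSet j i) (u : Fin (KL.len ν) → ℕ),
          (b (w, u) : KL.R Γ ν) = KL.hat Γ (word w) i * KL.dotMonomial Γ i u ∧
          b (w, u) ∈ KL.homDegPart Γ j i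
            ((KL.wordDiagram i (word w)).degree Γ + 2 * ∑ k, (u k : ℤ))) ∧
    (∀ o : KL.Orientation Γ,
      (∃! ρ : KL.R Γ ν →+* Module.End ℤ (KL.Pol ν), KL.IsPolAction o ρ) ∧
      ∀ ρ : KL.R Γ ν →+* Module.End ℤ (KL.Pol ν), KL.IsPolAction o ρ →
        Function.Injective ρ) := by
  refine ⟨fun i j => ⟨KL.isInternal_homDegPart hword j i, KL.hatBasis hword j i, fun w u =>
    ⟨KL.hatBasis_apply hword j i w u, KL.hatBasis_mem hword j i w u⟩⟩, fun o =>
    ⟨⟨KL.polAction o, KL.isPolAction_polAction o, fun ρ hρ => hρ.eq_polAction⟩, fun ρ hρ => ?_⟩⟩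
  rw [hρ.eq_polAction]
  exact KL.polAction_injective hword o
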